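/- For $n\ge 3$ and $0<p<1$, let $G(n,p)$ be the Erdős–Rényi random graph on $n$ labelled vertices, in which each of the $\binom n2$ possible edges is present independently with probability $p$. Let $T$ be the number of triangles in $G(n,p)$, let $W=(T-\mathbb{E}T)/\sqrt{\operatorname{Var}T}$, and let $\Phi$ be the standard normal distribution function. Let $d_{\mathrm K}(\mathscr L(W),\Phi)=\sup_{x\in\mathbb R}|\mathbb P(W\le x)-\Phi(x)|$ be the Kolmogorov distance. There is a universal constant $C$ such that, for every $n\ge 3$ and every $0<p<1$, $$ d_{\mathrm K}(\mathscr L(W),\Phi)\le \begin{cases} \dfrac{C}{n(1-p)^{1/2}} & \text{if } 1/2<p<1,\\[2ex] \dfrac{C}{n\,p^{1/2}} & \text{if } n^{-1/2}<p\le 1/2,\\[2ex] \dfrac{C}{n^{3/2}p^{3/2}} & \text{if } 0<p\le n^{-1/2}. \end{cases} $$ (When $n=3$ and $1/2<p\le 3^{-1/2}$, the first and the third case both apply, and both bounds hold.) -/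

import Mathlib

open MeasureTheory ProbabilityTheory

/-- The number of triangles in a graph on `n` labelled vertices, that is, the number of
three-element sets of vertices that are pairwise adjacent. -/
noncomputable def triangleCount {n : ℕ} (G : SimpleGraph (Fin n)) : ℝ :=
  ((G.cliqueSet 3).ncard : ℝ)

/-- The centred and normalised number of triangles `W = (T - E T) / (Var T)^{1/2}` in the
Erdős–Rényi random graph `G(n, p)` (each of the possible edges is present independently with
probability `p`), as a random variable on the space of graphs carrying the law of `G(n, p)`. -/
noncomputable def normalizedTriangleCount (n : ℕ) (p : unitInterval)
    (G : SimpleGraph (Fin n)) : ℝ :=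
  (triangleCount G - ∫ H, triangleCount H ∂(SimpleGraph.binomialRandom (Fin n) p)) /
    √(variance triangleCount (SimpleGraph.binomialRandom (Fin n) p))

/-- The law of `W` on the real line. -/
noncomputable def triangleLaw (n : ℕ) (p : unitInterval) : Measure ℝ :=
  (SimpleGraph.binomialRandom (Fin n) p).map (normalizedTriangleCount n p)

/-- The Kolmogorov distance of two probability measures on the real line: the supremum
distance of their distribution functions. -/
noncomputable def kolmogorovDist (μ ν : Measure ℝ) : ℝ :=
  ⨆ x : ℝ, |cdf μ x - cdf ν x|

/-! The proof is Stein's method on the cube of edge indicators `x_e`, each equal to `1` with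
probability `p` independently of the others; write `q = 1 - p` and `D_e` for the difference
between the values with and without the edge `e`.

Telescoping `x y z - p³` over labelled triangles gives `T - E T = ∑_{i ≠ j} (x_{ij} - p) M_{ij}`,
where the weight `M_{ij} ≥ 0` does not depend on the edge `ij`, while `D_{ij} T = N_{ij} ≥ 0` is the
number of common neighbours of `i` and `j` (`ncard_cliqueSet_three_sub`,
`cubeDiff_ncard_cliqueSet_three`). Integration by parts for Bernoulli variables
(`cubeExp_centred_mul`) then yields `E (T - E T) g(T) = p q ∑ E M_{ij} D_{ij} (g ∘ T)`.

Apply this with the solution `f` of the Stein equation `f'(w) = w f(w) + 1_{w ≤ x} - Φ(x)`. The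
usual obstacle to a Kolmogorov bound is the jump of `f'`. It is overcome by monotonicity: `w f(w)`
increases and `1_{w ≤ x}` decreases, so the error in replacing an increment of `f` by `f'` times
the step is at most the step times the increment of the bounded increasing function
`r(w) = w f(w) - 1_{w ≤ x}`. Since `M_{ij} N_{ij} ≥ 0`, integration by parts turns the sum of these
errors back into the expectation of `r` times a centred sum. With `v = Var T` this proves
(`abs_cubeExp_sub_cdf_le`)

`d_K ≤ (2 / v) E |v - p q ∑ M_{ij} N_{ij}| + (2 / v) E |∑ (x_{ij} - p) M_{ij} N_{ij}|`.

The expectation of `p q ∑ M_{ij} N_{ij}` is `v`, so the first term is controlled by the Poincaré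
inequality (`cubeExp_poincare`), and the second one by a second moment computation
(`cubeExp_sq_sum_centred_le`). Both need the effect of a single edge on `M_{ij} N_{ij}`. Everything
is dominated by the path count `1 + ∑_k (x_{ik} + p) (x_{jk} + p)`, which grows by at most a
constant factor when an edge is added; this makes all its moments computable by conditioning on
edges one at a time. With `μ = (n - 2) p²`, both squared errors are `O(n² p q μ (1 + μ)³)`, whereas
`v` is at least of order `n² p q μ (1 + μ)`. The distance is therefore of order at most
`((1 + μ) / (n² p q μ))^{1/2}`, which gives the three regimes. -/

/-! ### The Stein equation for the standard normal distribution -/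

lemma hasDerivAt_stdGaussianPDF (w : ℝ) :
    HasDerivAt (gaussianPDFReal 0 1) (-w * gaussianPDFReal 0 1 w) w := by
  have h : HasDerivAt (fun t : ℝ => -(t - 0) ^ 2 / (2 * ((1 : NNReal) : ℝ))) (-w) w := by
    have := (((hasDerivAt_id w).sub_const 0).pow 2).neg.div_const (2 * ((1 : NNReal) : ℝ))
    refine this.congr_deriv ?_
    simp
    ring
  have h2 := (h.exp).const_mul (√(2 * Real.pi * ((1 : NNReal) : ℝ)))⁻¹
  refine h2.congr_deriv ?_
  simp only [gaussianPDFReal]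
  ring

lemma continuous_stdGaussianPDF : Continuous (gaussianPDFReal 0 1) :=
  continuous_iff_continuousAt.2 fun w => (hasDerivAt_stdGaussianPDF w).continuousAt

lemma stdGaussianPDF_pos (w : ℝ) : 0 < gaussianPDFReal 0 1 w :=
  gaussianPDFReal_pos 0 1 w one_ne_zero

lemma stdGaussianPDF_neg (w : ℝ) : gaussianPDFReal 0 1 (-w) = gaussianPDFReal 0 1 w := by
  simp [gaussianPDFReal]

lemma tendsto_stdGaussianPDF_atBot :
    Filter.Tendsto (gaussianPDFReal 0 1) Filter.atBot (nhds 0) := by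
  have h := tendsto_rpow_abs_mul_exp_neg_mul_sq_cocompact (a := 1 / 2) (by norm_num) 0
  have h2 := (h.mono_left (show Filter.atBot ≤ Filter.cocompact ℝ from
    atBot_le_cocompact)).const_mul (√(2 * Real.pi))⁻¹
  simp only [mul_zero] at h2
  refine h2.congr fun w => ?_
  simp only [gaussianPDFReal, Real.rpow_zero]
  congr 2 <;> simp
  ring

lemma tendsto_mul_stdGaussianPDF_atBot :
    Filter.Tendsto (fun w => w * gaussianPDFReal 0 1 w) Filter.atBot (nhds 0) := by
  have h := tendsto_rpow_abs_mul_exp_neg_mul_sq_cocompact (a := 1 / 2) (by norm_num) 1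
  have h2 := (h.mono_left (show Filter.atBot ≤ Filter.cocompact ℝ from
    atBot_le_cocompact)).const_mul (√(2 * Real.pi))⁻¹
  simp only [mul_zero] at h2
  rw [tendsto_zero_iff_abs_tendsto_zero]
  refine h2.congr fun w => ?_
  simp only [gaussianPDFReal, Real.rpow_one, Function.comp, abs_mul, Real.abs_exp]
  rw [abs_of_nonneg (by positivity : (0 : ℝ) ≤ (√(2 * Real.pi * ((1 : NNReal) : ℝ)))⁻¹)]
  have : -(1 / 2) * w ^ 2 = -(w - 0) ^ 2 / (2 * ((1 : NNReal) : ℝ)) := by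
    simp; ring
  rw [this]
  simp
  ring

lemma hasDerivAt_cdf_stdGaussian (w : ℝ) :
    HasDerivAt (cdf (gaussianReal 0 1)) (gaussianPDFReal 0 1 w) w := by
  have hint := integrable_gaussianPDFReal 0 1
  have hcdf : ∀ x, cdf (gaussianReal 0 1) x
      = (∫ t in (0 : ℝ)..x, gaussianPDFReal 0 1 t) + cdf (gaussianReal 0 1) 0 := by
    have hx : ∀ x, cdf (gaussianReal 0 1) x = ∫ t in Set.Iic x, gaussianPDFReal 0 1 t := by
      intro x
      rw [cdf_eq_real, measureReal_def, gaussianReal_apply_eq_integral 0 one_ne_zero,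
        ENNReal.toReal_ofReal]
      exact integral_nonneg fun t => (stdGaussianPDF_pos t).le
    intro x
    rw [hx, hx, ← intervalIntegral.integral_Iic_sub_Iic hint.integrableOn hint.integrableOn]
    ring
  have h := (intervalIntegral.integral_hasDerivAt_right (a := 0) (b := w)
    (f := gaussianPDFReal 0 1) hint.intervalIntegrable
    (continuous_stdGaussianPDF.stronglyMeasurableAtFilter _ _)
    continuous_stdGaussianPDF.continuousAt).add_const (cdf (gaussianReal 0 1) 0)
  exact h.congr_of_eventuallyEq (Filter.Eventually.of_forall hcdf)

lemma cdf_stdGaussian_neg (w : ℝ) :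
    cdf (gaussianReal 0 1) (-w) = 1 - cdf (gaussianReal 0 1) w := by
  have hd : ∀ t, HasDerivAt
      (fun t => cdf (gaussianReal 0 1) (-t) + cdf (gaussianReal 0 1) t) 0 t := by
    intro t
    have h := ((hasDerivAt_cdf_stdGaussian (-t)).scomp t (hasDerivAt_neg t)).add
      (hasDerivAt_cdf_stdGaussian t)
    refine h.congr_deriv ?_
    rw [stdGaussianPDF_neg]
    simp
  have hc := is_const_of_deriv_eq_zero (fun t => (hd t).differentiableAt)
    (fun t => (hd t).deriv) w
  have hlim : Filter.Tendsto
      (fun t => cdf (gaussianReal 0 1) (-t) + cdf (gaussianReal 0 1) t) Filter.atTop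
      (nhds (0 + 1)) :=
    ((tendsto_cdf_atBot _).comp Filter.tendsto_neg_atTop_atBot).add (tendsto_cdf_atTop _)
  have hconst := tendsto_nhds_unique
    (hlim.congr fun t => (hc t).symm) tendsto_const_nhds
  linarith

/-- `φ(w) + w Φ(w) = ∫_{t ≤ w} (w - t) φ(t) dt`, hence nonnegative. -/
lemma stdGaussianPDF_add_mul_cdf_nonneg (w : ℝ) :
    0 ≤ gaussianPDFReal 0 1 w + w * cdf (gaussianReal 0 1) w := by
  have hd : ∀ t, HasDerivAt
      (fun t => gaussianPDFReal 0 1 t + w * cdf (gaussianReal 0 1) t)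
      ((w - t) * gaussianPDFReal 0 1 t) t := by
    intro t
    refine ((hasDerivAt_stdGaussianPDF t).add
      ((hasDerivAt_cdf_stdGaussian t).const_mul w)).congr_deriv ?_
    ring
  have hmono : MonotoneOn
      (fun t => gaussianPDFReal 0 1 t + w * cdf (gaussianReal 0 1) t) (Set.Iic w) := by
    refine monotoneOn_of_deriv_nonneg (convex_Iic w)
      (fun t _ => (hd t).continuousAt.continuousWithinAt)
      (fun t _ => (hd t).differentiableAt.differentiableWithinAt) fun t ht => ?_
    rw [interior_Iic] at ht
    rw [(hd t).deriv]
    exact mul_nonneg (sub_nonneg.2 (le_of_lt ht)) (stdGaussianPDF_pos t).le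
  have hlim : Filter.Tendsto
      (fun t => gaussianPDFReal 0 1 t + w * cdf (gaussianReal 0 1) t) Filter.atBot
      (nhds (0 + w * 0)) :=
    tendsto_stdGaussianPDF_atBot.add ((tendsto_cdf_atBot _).const_mul w)
  simp only [mul_zero, add_zero] at hlim
  refine le_of_tendsto hlim ?_
  filter_upwards [Filter.eventually_le_atBot w] with t ht
  exact hmono ht Set.self_mem_Iic ht

/-- `(1 + w²) Φ(w) + w φ(w) = ∫_{t ≤ w} (w - t)² φ(t) dt`, hence nonnegative. -/
lemma one_add_sq_mul_cdf_add_nonneg (w : ℝ) :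
    0 ≤ (1 + w ^ 2) * cdf (gaussianReal 0 1) w + w * gaussianPDFReal 0 1 w := by
  have hd : ∀ t, HasDerivAt
      (fun t => (1 + w ^ 2) * cdf (gaussianReal 0 1) t + 2 * w * gaussianPDFReal 0 1 t
        - t * gaussianPDFReal 0 1 t)
      ((w - t) ^ 2 * gaussianPDFReal 0 1 t) t := by
    intro t
    refine ((((hasDerivAt_cdf_stdGaussian t).const_mul (1 + w ^ 2)).add
      ((hasDerivAt_stdGaussianPDF t).const_mul (2 * w))).sub
      ((hasDerivAt_id t).mul (hasDerivAt_stdGaussianPDF t))).congr_deriv ?_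
    simp only [id]
    ring
  have hmono := monotone_of_deriv_nonneg (fun t => (hd t).differentiableAt) fun t => by
    rw [(hd t).deriv]
    exact mul_nonneg (sq_nonneg _) (stdGaussianPDF_pos t).le
  have hlim : Filter.Tendsto
      (fun t => (1 + w ^ 2) * cdf (gaussianReal 0 1) t + 2 * w * gaussianPDFReal 0 1 t
        - t * gaussianPDFReal 0 1 t) Filter.atBot
      (nhds ((1 + w ^ 2) * 0 + 2 * w * 0 - 0)) :=
    (((tendsto_cdf_atBot _).const_mul _).add
      (tendsto_stdGaussianPDF_atBot.const_mul _)).sub tendsto_mul_stdGaussianPDF_atBot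
  have h := hmono.le_of_tendsto hlim w
  linarith

/-- The ratio `Φ / φ`, that is, Mills' ratio of the standard normal distribution at `-w`. -/
noncomputable def millsRatio (w : ℝ) : ℝ :=
  cdf (gaussianReal 0 1) w / gaussianPDFReal 0 1 w

lemma hasDerivAt_millsRatio (w : ℝ) : HasDerivAt millsRatio (1 + w * millsRatio w) w := by
  have hw := (stdGaussianPDF_pos w).ne'
  refine ((hasDerivAt_cdf_stdGaussian w).div (hasDerivAt_stdGaussianPDF w) hw).congr_deriv ?_
  rw [millsRatio]
  field_simp
  ring

lemma neg_one_le_mul_millsRatio (w : ℝ) : -1 ≤ w * millsRatio w := by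
  have h := stdGaussianPDF_add_mul_cdf_nonneg w
  have hw := stdGaussianPDF_pos w
  rw [millsRatio, ← mul_div_assoc, le_div_iff₀ hw]
  linarith

lemma monotone_mul_millsRatio : Monotone fun w => w * millsRatio w := by
  have hd : ∀ w, HasDerivAt (fun w => w * millsRatio w)
      (millsRatio w + w * (1 + w * millsRatio w)) w := fun w =>
    ((hasDerivAt_id w).mul (hasDerivAt_millsRatio w)).congr_deriv (by simp)
  refine monotone_of_deriv_nonneg (fun t => (hd t).differentiableAt) fun w => ?_
  rw [(hd w).deriv]
  have h := one_add_sq_mul_cdf_add_nonneg w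
  have hw := stdGaussianPDF_pos w
  have : millsRatio w + w * (1 + w * millsRatio w)
      = ((1 + w ^ 2) * cdf (gaussianReal 0 1) w + w * gaussianPDFReal 0 1 w)
        / gaussianPDFReal 0 1 w := by
    rw [millsRatio]
    field_simp
    ring
  rw [this]
  exact div_nonneg h hw.le

/-- The bounded solution `f` of the Stein equation `f'(w) - w f(w) = 1_{w ≤ x} - Φ(x)`. -/
noncomputable def steinSolution (x w : ℝ) : ℝ :=
  if w ≤ x then millsRatio w * (1 - cdf (gaussianReal 0 1) x)
  else millsRatio (-w) * cdf (gaussianReal 0 1) x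

lemma steinSolution_of_le {x w : ℝ} (h : w ≤ x) :
    steinSolution x w = millsRatio w * (1 - cdf (gaussianReal 0 1) x) := if_pos h

lemma steinSolution_of_ge {x w : ℝ} (h : x ≤ w) :
    steinSolution x w = millsRatio (-w) * cdf (gaussianReal 0 1) x := by
  rcases h.eq_or_lt with rfl | h
  · rw [steinSolution_of_le le_rfl, millsRatio, millsRatio, cdf_stdGaussian_neg,
      stdGaussianPDF_neg]
    ring
  · exact if_neg (not_le.2 h)

lemma monotone_mul_steinSolution (x : ℝ) : Monotone fun w => w * steinSolution x w := by
  refine MonotoneOn.Iic_union_Ici (a := x) ?_ ?_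
  · intro a ha b hb hab
    simp only [steinSolution_of_le ha, steinSolution_of_le hb, ← mul_assoc]
    exact mul_le_mul_of_nonneg_right (monotone_mul_millsRatio hab)
      (sub_nonneg.2 (cdf_le_one _ _))
  · intro a ha b hb hab
    simp only [steinSolution_of_ge ha, steinSolution_of_ge hb, ← mul_assoc]
    have h := monotone_mul_millsRatio (neg_le_neg hab)
    simp only at h
    exact mul_le_mul_of_nonneg_right (by linarith) (cdf_nonneg _ _)

lemma abs_mul_steinSolution_le (x w : ℝ) : |w * steinSolution x w| ≤ 1 := by
  have h0 := cdf_nonneg (gaussianReal 0 1) x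
  have h1 := cdf_le_one (gaussianReal 0 1) x
  have hlow : ∀ w ≤ x, -1 ≤ w * steinSolution x w := fun w hw => by
    rw [steinSolution_of_le hw, ← mul_assoc]
    nlinarith [neg_one_le_mul_millsRatio w]
  have hup : ∀ w, x ≤ w → w * steinSolution x w ≤ 1 := fun w hw => by
    rw [steinSolution_of_ge hw, ← mul_assoc]
    nlinarith [neg_one_le_mul_millsRatio (-w)]
  have hmono := monotone_mul_steinSolution x
  rw [abs_le]
  rcases le_total w x with h | h
  · exact ⟨hlow w h, (hmono h).trans (hup x le_rfl)⟩
  · exact ⟨(hlow x le_rfl).trans (hmono h), hup w h⟩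

lemma sub_bounds_of_deriv_bounds {f f' : ℝ → ℝ} {a b l u : ℝ} (hab : a ≤ b)
    (hd : ∀ t, HasDerivAt f (f' t) t) (hl : ∀ t ∈ Set.Icc a b, l ≤ f' t)
    (hu : ∀ t ∈ Set.Icc a b, f' t ≤ u) :
    (b - a) * l ≤ f b - f a ∧ f b - f a ≤ (b - a) * u := by
  have hc : ContinuousOn f (Set.Icc a b) := fun t _ => (hd t).continuousAt.continuousWithinAt
  have hdiff : DifferentiableOn ℝ f (interior (Set.Icc a b)) :=
    fun t _ => (hd t).differentiableAt.differentiableWithinAt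
  constructor
  · have := (convex_Icc a b).mul_sub_le_image_sub_of_le_deriv hc hdiff (C := l)
      (fun t ht => by rw [(hd t).deriv]; exact hl t (interior_subset ht)) a
      (Set.left_mem_Icc.2 hab) b (Set.right_mem_Icc.2 hab) hab
    linarith
  · have := (convex_Icc a b).image_sub_le_mul_sub_of_deriv_le hc hdiff (C := u)
      (fun t ht => by rw [(hd t).deriv]; exact hu t (interior_subset ht)) a
      (Set.left_mem_Icc.2 hab) b (Set.right_mem_Icc.2 hab) hab
    linarith

/-- Increments of the Stein solution: since `w f(w)` increases and `1_{w ≤ x}` decreases, the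
derivative `w f(w) + 1_{w ≤ x} - Φ(x)` can be bounded on `[a, b]` by values at the end points. -/
lemma steinSolution_sub_bounds (x : ℝ) {a b : ℝ} (hab : a ≤ b) :
    (b - a) * (a * steinSolution x a + (if b ≤ x then 1 else 0) - cdf (gaussianReal 0 1) x)
        ≤ steinSolution x b - steinSolution x a ∧
      steinSolution x b - steinSolution x a
        ≤ (b - a) * (b * steinSolution x b + (if a ≤ x then 1 else 0)
          - cdf (gaussianReal 0 1) x) := by
  have hmono := monotone_mul_steinSolution x
  have hleft : ∀ a b : ℝ, a ≤ b → b ≤ x →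
      (b - a) * (a * steinSolution x a + 1 - cdf (gaussianReal 0 1) x)
        ≤ steinSolution x b - steinSolution x a ∧
      steinSolution x b - steinSolution x a
        ≤ (b - a) * (b * steinSolution x b + 1 - cdf (gaussianReal 0 1) x) := by
    intro a b hab hb
    have hd : ∀ t, HasDerivAt (fun t => millsRatio t * (1 - cdf (gaussianReal 0 1) x))
        ((1 + t * millsRatio t) * (1 - cdf (gaussianReal 0 1) x)) t :=
      fun t => (hasDerivAt_millsRatio t).mul_const _
    have hval : ∀ t ≤ x, (1 + t * millsRatio t) * (1 - cdf (gaussianReal 0 1) x)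
        = t * steinSolution x t + 1 - cdf (gaussianReal 0 1) x := fun t ht => by
      rw [steinSolution_of_le ht]; ring
    have := sub_bounds_of_deriv_bounds hab hd
      (l := a * steinSolution x a + 1 - cdf (gaussianReal 0 1) x)
      (u := b * steinSolution x b + 1 - cdf (gaussianReal 0 1) x)
      (fun t ht => by
        rw [hval t (ht.2.trans hb)]
        have := hmono ht.1
        simp only at this
        linarith)
      (fun t ht => by
        rw [hval t (ht.2.trans hb)]
        have := hmono ht.2
        simp only at this
        linarith)
    rwa [← steinSolution_of_le hb, ← steinSolution_of_le (hab.trans hb)] at this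
  have hright : ∀ a b : ℝ, a ≤ b → x ≤ a →
      (b - a) * (a * steinSolution x a - cdf (gaussianReal 0 1) x)
        ≤ steinSolution x b - steinSolution x a ∧
      steinSolution x b - steinSolution x a
        ≤ (b - a) * (b * steinSolution x b - cdf (gaussianReal 0 1) x) := by
    intro a b hab ha
    have hd : ∀ t, HasDerivAt (fun t => millsRatio (-t) * cdf (gaussianReal 0 1) x)
        ((-(1 + (-t) * millsRatio (-t))) * cdf (gaussianReal 0 1) x) t := fun t => by
      have := ((hasDerivAt_millsRatio (-t)).scomp t (hasDerivAt_neg t)).mul_const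
        (cdf (gaussianReal 0 1) x)
      refine this.congr_deriv ?_
      simp
    have hval : ∀ t, x ≤ t → (-(1 + (-t) * millsRatio (-t))) * cdf (gaussianReal 0 1) x
        = t * steinSolution x t - cdf (gaussianReal 0 1) x := fun t ht => by
      rw [steinSolution_of_ge ht]; ring
    have := sub_bounds_of_deriv_bounds hab hd
      (l := a * steinSolution x a - cdf (gaussianReal 0 1) x)
      (u := b * steinSolution x b - cdf (gaussianReal 0 1) x)
      (fun t ht => by
        rw [hval t (ha.trans ht.1)]
        have := hmono ht.1
        simp only at this
        linarith)
      (fun t ht => by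
        rw [hval t (ha.trans ht.1)]
        have := hmono ht.2
        simp only at this
        linarith)
    rwa [← steinSolution_of_ge ha, ← steinSolution_of_ge (ha.trans hab)] at this
  by_cases hb : b ≤ x
  · rw [if_pos hb, if_pos (hab.trans hb)]
    exact hleft a b hab hb
  · rw [if_neg hb]
    rw [not_le] at hb
    by_cases ha : a ≤ x
    · rw [if_pos ha]
      have h1 := hleft a x ha le_rfl
      have h2 := hright x b hb.le le_rfl
      have h3 := hmono ha
      have h4 := hmono hb.le
      simp only at h3 h4
      constructor
      · nlinarith [h1.1, h2.1]
      · nlinarith [h1.2, h2.2]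
    · rw [if_neg ha]
      have := hright a b hab (not_le.1 ha).le
      simpa using this

/-! ### Independent Bernoulli variables on a finite set -/

/-- The expectation of `F` at a random subset of `S` that contains each element of `S`
independently with probability `p`. -/
noncomputable def cubeExp {α : Type*} [DecidableEq α] (p : ℝ) (S : Finset α)
    (F : Finset α → ℝ) : ℝ :=
  ∑ s ∈ S.powerset, p ^ s.card * (1 - p) ^ (S \ s).card * F s

/-- The difference operator in the coordinate `e`. -/
def cubeDiff {α : Type*} [DecidableEq α] (e : α) (F : Finset α → ℝ) (s : Finset α) : ℝ :=
  F (insert e s) - F (s.erase e)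

/-- The function `F` does not depend on whether `e` belongs to its argument. -/
def IgnoresCoord {α : Type*} [DecidableEq α] (e : α) (F : Finset α → ℝ) : Prop :=
  ∀ s, F (insert e s) = F s

/-- The indicator of the event that the random set contains `e`. -/
def coordInd {α : Type*} [DecidableEq α] (e : α) (s : Finset α) : ℝ := if e ∈ s then 1 else 0

section Cube

variable {α : Type*} [DecidableEq α] {p : ℝ} {S : Finset α} {e a : α} {F G : Finset α → ℝ}

lemma cubeExp_congr (h : ∀ s ⊆ S, F s = G s) : cubeExp p S F = cubeExp p S G :=
  Finset.sum_congr rfl fun s hs => by rw [h s (Finset.mem_powerset.1 hs)]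

lemma cubeExp_add : cubeExp p S (fun s => F s + G s) = cubeExp p S F + cubeExp p S G := by
  simp only [cubeExp, mul_add, Finset.sum_add_distrib]

lemma cubeExp_sub : cubeExp p S (fun s => F s - G s) = cubeExp p S F - cubeExp p S G := by
  simp only [cubeExp, mul_sub, Finset.sum_sub_distrib]

lemma cubeExp_const_mul (c : ℝ) : cubeExp p S (fun s => c * F s) = c * cubeExp p S F := by
  simp only [cubeExp, Finset.mul_sum]
  exact Finset.sum_congr rfl fun s _ => by ring

lemma cubeExp_sum {ι : Type*} (t : Finset ι) (H : ι → Finset α → ℝ) :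
    cubeExp p S (fun s => ∑ i ∈ t, H i s) = ∑ i ∈ t, cubeExp p S (H i) := by
  simp only [cubeExp, Finset.mul_sum]
  exact Finset.sum_comm

lemma cubeExp_mono (hp0 : 0 ≤ p) (hp1 : p ≤ 1) (h : ∀ s ⊆ S, F s ≤ G s) :
    cubeExp p S F ≤ cubeExp p S G := by
  have : 0 ≤ 1 - p := sub_nonneg.2 hp1
  exact Finset.sum_le_sum fun s hs =>
    mul_le_mul_of_nonneg_left (h s (Finset.mem_powerset.1 hs)) (by positivity)

lemma cubeExp_insert (he : e ∉ S) :
    cubeExp p (insert e S) F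
      = (1 - p) * cubeExp p S F + p * cubeExp p S (fun s => F (insert e s)) := by
  rw [cubeExp, Finset.sum_powerset_insert he]
  simp only [cubeExp, Finset.mul_sum]
  congr 1
  · refine Finset.sum_congr rfl fun s hs => ?_
    have hes : e ∉ s := fun h => he (Finset.mem_powerset.1 hs h)
    rw [Finset.insert_sdiff_of_notMem _ hes, Finset.card_insert_of_notMem
      (fun h => he (Finset.mem_sdiff.1 h).1)]
    ring
  · refine Finset.sum_congr rfl fun s hs => ?_
    have hes : e ∉ s := fun h => he (Finset.mem_powerset.1 hs h)
    rw [Finset.card_insert_of_notMem hes, Finset.insert_sdiff_insert,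
      Finset.sdiff_insert_of_notMem he]
    ring

lemma cubeExp_const (c : ℝ) : cubeExp p S (fun _ => c) = c := by
  induction S using Finset.induction_on with
  | empty => simp [cubeExp]
  | insert e S he ih => rw [cubeExp_insert he, ih]; ring

lemma cubeExp_nonneg (hp0 : 0 ≤ p) (hp1 : p ≤ 1) (h : ∀ s ⊆ S, 0 ≤ F s) :
    0 ≤ cubeExp p S F := by
  have := cubeExp_mono hp0 hp1 h
  rwa [cubeExp_const] at this

lemma abs_cubeExp_le (hp0 : 0 ≤ p) (hp1 : p ≤ 1) :
    |cubeExp p S F| ≤ cubeExp p S (fun s => |F s|) := by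
  rw [abs_le]
  constructor
  · have : cubeExp p S (fun s => (-1) * |F s|) ≤ cubeExp p S F :=
      cubeExp_mono hp0 hp1 fun s _ => by linarith [neg_abs_le (F s)]
    rw [cubeExp_const_mul] at this
    linarith
  · exact cubeExp_mono hp0 hp1 fun s _ => le_abs_self _

lemma sq_cubeExp_le (hp0 : 0 ≤ p) (hp1 : p ≤ 1) :
    cubeExp p S F ^ 2 ≤ cubeExp p S (fun s => F s ^ 2) := by
  have h : 0 ≤ cubeExp p S (fun s => (F s - cubeExp p S F) ^ 2) :=
    cubeExp_nonneg hp0 hp1 fun s _ => sq_nonneg _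
  have h2 : cubeExp p S (fun s => (F s - cubeExp p S F) ^ 2)
      = cubeExp p S (fun s => F s ^ 2) - 2 * cubeExp p S F * cubeExp p S F
        + cubeExp p S F ^ 2 := by
    rw [← cubeExp_const_mul, ← cubeExp_sub]
    conv_rhs => rw [← cubeExp_const (p := p) (S := S) (cubeExp p S F ^ 2)]
    rw [← cubeExp_add]
    exact cubeExp_congr fun s _ => by ring
  nlinarith

lemma cubeExp_abs_le_sqrt (hp0 : 0 ≤ p) (hp1 : p ≤ 1) :
    cubeExp p S (fun s => |F s|) ≤ √(cubeExp p S (fun s => F s ^ 2)) := by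
  refine Real.le_sqrt_of_sq_le ((sq_cubeExp_le hp0 hp1).trans_eq ?_)
  simp only [sq_abs]

/-- Resampling one coordinate does not change expectations. -/
lemma cubeExp_resample (he : e ∈ S) :
    cubeExp p S F
      = cubeExp p S (fun s => p * F (insert e s) + (1 - p) * F (s.erase e)) := by
  obtain ⟨T, heT, rfl⟩ : ∃ T, e ∉ T ∧ insert e T = S :=
    ⟨S.erase e, Finset.notMem_erase e S, Finset.insert_erase he⟩
  rw [cubeExp_insert heT, cubeExp_insert heT]
  have h1 : cubeExp p T (fun s => p * F (insert e s) + (1 - p) * F (s.erase e))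
      = p * cubeExp p T (fun s => F (insert e s)) + (1 - p) * cubeExp p T F := by
    rw [← cubeExp_const_mul, ← cubeExp_const_mul, ← cubeExp_add]
    exact cubeExp_congr fun s hs => by rw [Finset.erase_eq_of_notMem fun h => heT (hs h)]
  have h2 : cubeExp p T (fun s => p * F (insert e (insert e s))
        + (1 - p) * F ((insert e s).erase e))
      = p * cubeExp p T (fun s => F (insert e s)) + (1 - p) * cubeExp p T F := by
    rw [← cubeExp_const_mul, ← cubeExp_const_mul, ← cubeExp_add]
    exact cubeExp_congr fun s hs => by
      rw [Finset.insert_idem, Finset.erase_insert fun h => heT (hs h)]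
  rw [h1, h2]
  ring

lemma IgnoresCoord.erase_eq (h : IgnoresCoord e F) (s : Finset α) : F (s.erase e) = F s := by
  by_cases he : e ∈ s
  · rw [← h (s.erase e), Finset.insert_erase he]
  · rw [Finset.erase_eq_of_notMem he]

lemma IgnoresCoord.mul (hF : IgnoresCoord e F) (hG : IgnoresCoord e G) :
    IgnoresCoord e (fun s => F s * G s) := fun s => by simp only [hF s, hG s]

lemma ignoresCoord_cubeDiff : IgnoresCoord e (cubeDiff e F) := fun s => by
  rw [cubeDiff, cubeDiff, Finset.insert_idem]
  congr 2
  ext b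
  simp only [Finset.mem_erase, Finset.mem_insert]
  tauto

lemma IgnoresCoord.cubeDiff_mul (hF : IgnoresCoord e F) (s : Finset α) :
    cubeDiff e (fun s => F s * G s) s = F s * cubeDiff e G s := by
  simp only [cubeDiff, hF s, hF.erase_eq]
  ring

lemma IgnoresCoord.cubeDiff_of (hF : IgnoresCoord e F) : IgnoresCoord e (cubeDiff a F) := by
  intro s
  rcases eq_or_ne a e with rfl | hae
  · exact ignoresCoord_cubeDiff s
  · rw [cubeDiff, cubeDiff, Finset.insert_comm, hF, Finset.erase_insert_of_ne hae.symm, hF]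

lemma coordInd_insert_self (s : Finset α) : coordInd e (insert e s) = 1 := by simp [coordInd]

lemma coordInd_erase_self (s : Finset α) : coordInd e (s.erase e) = 0 := by simp [coordInd]

lemma ignoresCoord_coordInd (h : e ≠ a) : IgnoresCoord e (coordInd a) := fun s => by
  simp [coordInd, h.symm]

lemma coordInd_nonneg (s : Finset α) : 0 ≤ coordInd e s := by
  rw [coordInd]; split_ifs <;> norm_num

lemma coordInd_le_one (s : Finset α) : coordInd e s ≤ 1 := by
  rw [coordInd]; split_ifs <;> norm_num

lemma cubeExp_coordInd_mul (he : e ∈ S) :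
    cubeExp p S (fun s => coordInd e s * F s)
      = p * cubeExp p S (fun s => F (insert e s)) := by
  rw [cubeExp_resample he, ← cubeExp_const_mul]
  exact cubeExp_congr fun s _ => by rw [coordInd_insert_self, coordInd_erase_self]; ring

/-- Integration by parts for a centred Bernoulli variable. -/
lemma cubeExp_centred_mul (he : e ∈ S) (hG : IgnoresCoord e G) :
    cubeExp p S (fun s => (coordInd e s - p) * G s * F s)
      = p * (1 - p) * cubeExp p S (fun s => G s * cubeDiff e F s) := by
  rw [cubeExp_resample he, ← cubeExp_const_mul]
  refine cubeExp_congr fun s _ => ?_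
  rw [coordInd_insert_self, coordInd_erase_self, hG s, hG.erase_eq, cubeDiff]
  ring

/-- The Poincaré (Efron-Stein) inequality for independent Bernoulli variables. -/
lemma cubeExp_poincare (hp0 : 0 ≤ p) (hp1 : p ≤ 1) (S : Finset α) (F : Finset α → ℝ) :
    cubeExp p S (fun s => F s ^ 2) - cubeExp p S F ^ 2
      ≤ p * (1 - p) * ∑ e ∈ S, cubeExp p S (fun s => cubeDiff e F s ^ 2) := by
  have hq : 0 ≤ 1 - p := sub_nonneg.2 hp1
  induction S using Finset.induction_on generalizing F with
  | empty => simp [cubeExp]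
  | insert e S he ih =>
    have hnot : ∀ s ⊆ S, e ∉ s := fun s hs h => he (hs h)
    set A : Finset α → ℝ := fun s => (1 - p) * F s + p * F (insert e s) with hA
    have hA' : cubeExp p S A = cubeExp p (insert e S) F := by
      rw [cubeExp_insert he, hA, cubeExp_add, cubeExp_const_mul, cubeExp_const_mul]
    have hsq : cubeExp p (insert e S) (fun s => F s ^ 2)
        = p * (1 - p) * cubeExp p S (fun s => (F (insert e s) - F s) ^ 2)
          + cubeExp p S (fun s => A s ^ 2) := by
      rw [cubeExp_insert he, ← cubeExp_const_mul, ← cubeExp_const_mul, ← cubeExp_const_mul,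
        ← cubeExp_add, ← cubeExp_add]
      exact cubeExp_congr fun s _ => by simp only [hA]; ring
    have hself : cubeExp p (insert e S) (fun s => cubeDiff e F s ^ 2)
        = cubeExp p S (fun s => (F (insert e s) - F s) ^ 2) := by
      rw [cubeExp_insert he, ← cubeExp_const_mul, ← cubeExp_const_mul, ← cubeExp_add]
      refine cubeExp_congr fun s hs => ?_
      rw [ignoresCoord_cubeDiff s, cubeDiff, Finset.erase_eq_of_notMem (hnot s hs)]
      ring
    have hother : ∀ a ∈ S, cubeExp p S (fun s => cubeDiff a A s ^ 2)
        ≤ cubeExp p (insert e S) (fun s => cubeDiff a F s ^ 2) := by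
      intro a ha
      have hea : e ≠ a := fun h => he (h ▸ ha)
      rw [cubeExp_insert he, ← cubeExp_const_mul, ← cubeExp_const_mul, ← cubeExp_add]
      refine cubeExp_mono hp0 hp1 fun s _ => ?_
      have : cubeDiff a A s
          = (1 - p) * cubeDiff a F s + p * cubeDiff a F (insert e s) := by
        simp only [cubeDiff, hA, Finset.erase_insert_of_ne hea, Finset.insert_comm a e]
        ring
      rw [this]
      nlinarith [mul_nonneg (mul_nonneg hp0 hq)
        (sq_nonneg (cubeDiff a F s - cubeDiff a F (insert e s)))]
    rw [Finset.sum_insert he, hself, hsq, ← hA', mul_add]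
    have h1 := ih A
    have h2 := mul_le_mul_of_nonneg_left (Finset.sum_le_sum hother) (mul_nonneg hp0 hq)
    linarith

/-- Second moment of a sum of centred Bernoulli variables with weights `U j` that do not depend
on the respective coordinate; the cross terms are controlled by the differences of the weights. -/
lemma cubeExp_sq_sum_centred_le {J : Type*} [Fintype J] (hp0 : 0 ≤ p) (hp1 : p ≤ 1)
    (e : J → α) (he : ∀ j, e j ∈ S) (hmult : ∀ j, {j' | e j' = e j}.ncard ≤ 2)
    (U : J → Finset α → ℝ) (hU : ∀ j, IgnoresCoord (e j) (U j)) :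
    cubeExp p S (fun s => (∑ j, (coordInd (e j) s - p) * U j s) ^ 2)
      ≤ 2 * (p * (1 - p)) * ∑ j, cubeExp p S (fun s => U j s ^ 2)
        + (p * (1 - p)) ^ 2 * ∑ j, ∑ j', cubeExp p S (fun s => cubeDiff (e j') (U j) s ^ 2) := by
  classical
  have hq : 0 ≤ 1 - p := sub_nonneg.2 hp1
  have hpq := mul_nonneg hp0 hq
  have hexp : cubeExp p S (fun s => (∑ j, (coordInd (e j) s - p) * U j s) ^ 2)
      = ∑ j, ∑ j', cubeExp p S (fun s =>
        (coordInd (e j) s - p) * U j s * ((coordInd (e j') s - p) * U j' s)) := by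
    simp only [← cubeExp_sum]
    exact cubeExp_congr fun s _ => by rw [sq, Finset.sum_mul_sum]
  have hterm : ∀ j j', cubeExp p S (fun s =>
        (coordInd (e j) s - p) * U j s * ((coordInd (e j') s - p) * U j' s))
      ≤ (if e j' = e j then p * (1 - p) * (2⁻¹ * (cubeExp p S (fun s => U j s ^ 2)
          + cubeExp p S (fun s => U j' s ^ 2))) else 0)
        + (p * (1 - p)) ^ 2 * (2⁻¹ * (cubeExp p S (fun s => cubeDiff (e j') (U j) s ^ 2)
          + cubeExp p S (fun s => cubeDiff (e j) (U j') s ^ 2))) := by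
    intro j j'
    have hnn : ∀ (i : J) (a : α), 0 ≤ cubeExp p S (fun s => cubeDiff a (U i) s ^ 2) :=
      fun i a => cubeExp_nonneg hp0 hp1 fun s _ => sq_nonneg _
    rw [cubeExp_centred_mul (he j) (hU j)]
    by_cases h : e j' = e j
    · rw [if_pos h]
      have hstep : cubeExp p S (fun s => U j s *
            cubeDiff (e j) (fun s => (coordInd (e j') s - p) * U j' s) s)
          ≤ 2⁻¹ * (cubeExp p S (fun s => U j s ^ 2) + cubeExp p S (fun s => U j' s ^ 2)) := by
        rw [← cubeExp_add, ← cubeExp_const_mul]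
        refine cubeExp_mono hp0 hp1 fun s _ => ?_
        have hU' := hU j'
        rw [h] at hU'
        rw [cubeDiff, h, hU' s, hU'.erase_eq, coordInd_insert_self, coordInd_erase_self]
        nlinarith [sq_nonneg (U j s - U j' s)]
      have h1 := mul_le_mul_of_nonneg_left hstep hpq
      have h2 : 0 ≤ (p * (1 - p)) ^ 2 *
          (2⁻¹ * (cubeExp p S (fun s => cubeDiff (e j') (U j) s ^ 2)
          + cubeExp p S (fun s => cubeDiff (e j) (U j') s ^ 2))) := by
        have := hnn j (e j')
        have := hnn j' (e j)
        positivity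
      linarith
    · rw [if_neg h, zero_add]
      have hind : IgnoresCoord (e j) (fun s => coordInd (e j') s - p) := fun s => by
        simp only [ignoresCoord_coordInd (Ne.symm h) s]
      have hrw : cubeExp p S (fun s => U j s *
            cubeDiff (e j) (fun s => (coordInd (e j') s - p) * U j' s) s)
          = p * (1 - p) * cubeExp p S (fun s =>
            cubeDiff (e j) (U j') s * cubeDiff (e j') (U j) s) := by
        rw [← cubeExp_centred_mul (he j') (hU j').cubeDiff_of]
        refine cubeExp_congr fun s _ => ?_
        rw [hind.cubeDiff_mul]
        ring
      rw [hrw, ← mul_assoc, ← sq, ← cubeExp_add, ← cubeExp_const_mul 2⁻¹]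
      refine mul_le_mul_of_nonneg_left (cubeExp_mono (α := α) hp0 hp1 fun s _ => ?_) (sq_nonneg (p * (1 - p)))
      nlinarith [sq_nonneg (cubeDiff (e j) (U j') s - cubeDiff (e j') (U j) s)]
  rw [hexp]
  refine (Finset.sum_le_sum fun j _ => Finset.sum_le_sum fun j' _ => hterm j j').trans ?_
  simp only [Finset.sum_add_distrib]
  refine add_le_add ?_ (le_of_eq ?_)
  · set V : J → ℝ := fun j => cubeExp p S (fun s => U j s ^ 2) with hV
    have hV0 : ∀ j, 0 ≤ V j := fun j => cubeExp_nonneg hp0 hp1 fun s _ => sq_nonneg _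
    have hcard : ∀ j, ∑ j', (if e j' = e j then V j else 0) ≤ 2 * V j := by
      intro j
      rw [← Finset.sum_filter, Finset.sum_const, nsmul_eq_mul]
      refine mul_le_mul_of_nonneg_right ?_ (hV0 j)
      have := hmult j
      rw [Set.ncard_eq_toFinset_card'] at this
      rw [← Set.toFinset_ofPred]
      exact_mod_cast this
    have hsymm : ∑ j, ∑ j', (if e j' = e j then V j' else 0)
        = ∑ j, ∑ j', (if e j' = e j then V j else 0) := by
      rw [Finset.sum_comm]
      simp only [eq_comm]
    have hsplit : ∑ j, ∑ j', (if e j' = e j then p * (1 - p) * (2⁻¹ * (V j + V j')) else 0)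
        = p * (1 - p) * 2⁻¹ * (∑ j, ∑ j', (if e j' = e j then V j else 0)
          + ∑ j, ∑ j', (if e j' = e j then V j' else 0)) := by
      simp only [← Finset.sum_add_distrib, Finset.mul_sum]
      refine Finset.sum_congr rfl fun j _ => Finset.sum_congr rfl fun j' _ => ?_
      split_ifs <;> ring
    rw [hsplit, hsymm]
    have h3 := Finset.sum_le_sum fun j (_ : j ∈ Finset.univ) => hcard j
    rw [← Finset.mul_sum] at h3
    nlinarith
  · simp only [← Finset.mul_sum, Finset.sum_add_distrib]
    have hcomm : ∑ j, ∑ j', cubeExp p S (fun s => cubeDiff (e j) (U j') s ^ 2)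
        = ∑ j, ∑ j', cubeExp p S (fun s => cubeDiff (e j') (U j) s ^ 2) := Finset.sum_comm
    rw [hcomm]
    ring

/-- Stein's method for an increasing function `W` of independent Bernoulli variables that is
written as a sum of centred variables `coordInd (e j) - p` with nonnegative weights `M j`, each
independent of its own variable. -/
theorem abs_cubeExp_sub_cdf_le {J : Type*} [Fintype J] (hp0 : 0 ≤ p) (hp1 : p ≤ 1)
    (W : Finset α → ℝ) (e : J → α) (he : ∀ j, e j ∈ S) (M : J → Finset α → ℝ)
    (hM0 : ∀ j s, 0 ≤ M j s) (hMe : ∀ j, IgnoresCoord (e j) (M j))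
    (hW : ∀ s ⊆ S, W s = ∑ j, (coordInd (e j) s - p) * M j s)
    (hmono : ∀ j s, 0 ≤ cubeDiff (e j) W s) (x : ℝ) :
    |cubeExp p S (fun s => if W s ≤ x then 1 else 0) - cdf (gaussianReal 0 1) x|
      ≤ 2 * cubeExp p S (fun s => |1 - p * (1 - p) * ∑ j, M j s * cubeDiff (e j) W s|)
        + 2 * cubeExp p S
          (fun s => |∑ j, (coordInd (e j) s - p) * (M j s * cubeDiff (e j) W s)|) := by
  have hq : 0 ≤ 1 - p := sub_nonneg.2 hp1
  have hpq := mul_nonneg hp0 hq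
  set Φ : ℝ := cdf (gaussianReal 0 1) x with hΦ
  have hΦ0 : 0 ≤ Φ := cdf_nonneg _ _
  have hΦ1 : Φ ≤ 1 := cdf_le_one _ _
  set f := steinSolution x with hf
  -- `h` is the derivative of `f` away from `x`, and `r` is increasing.
  set h : ℝ → ℝ := fun w => w * f w + (if w ≤ x then 1 else 0) - Φ with hh
  set r : ℝ → ℝ := fun w => w * f w - (if w ≤ x then 1 else 0) with hr
  have hg := abs_mul_steinSolution_le x
  have hhb : ∀ w, |h w| ≤ 2 := fun w => by
    have := abs_le.1 (hg w)
    rw [abs_le]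
    simp only [hh]
    split_ifs <;> constructor <;> linarith [this.1, this.2]
  have hrb : ∀ w, |r w| ≤ 2 := fun w => by
    have := abs_le.1 (hg w)
    rw [abs_le]
    simp only [hr]
    split_ifs <;> constructor <;> linarith [this.1, this.2]
  have hgm := monotone_mul_steinSolution x
  -- All values of the derivative on `[a, b]`, and hence this average of the end point values, lie
  -- in an interval whose length is the increment of `r`.
  have hincr : ∀ a b : ℝ, a ≤ b →
      |f b - f a - (b - a) * (p * h b + (1 - p) * h a)| ≤ (b - a) * (r b - r a) := by
    intro a b hab
    obtain ⟨h1, h2⟩ := steinSolution_sub_bounds x hab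
    have h3 := hgm hab
    simp only at h3
    set i : ℝ → ℝ := fun w => if w ≤ x then 1 else 0 with hi
    have h4 : i b ≤ i a := by
      simp only [hi]
      split_ifs <;> first | (exfalso; linarith) | norm_num
    have hba : 0 ≤ b - a := sub_nonneg.2 hab
    have hup : p * h b + (1 - p) * h a ≤ b * f b + i a - Φ := by
      simp only [hh]
      nlinarith
    have hlow : a * f a + i b - Φ ≤ p * h b + (1 - p) * h a := by
      simp only [hh]
      nlinarith
    have h5 := mul_le_mul_of_nonneg_left hup hba
    have h6 := mul_le_mul_of_nonneg_left hlow hba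
    rw [abs_le]
    simp only [hr]
    constructor <;> nlinarith
  have hWf : cubeExp p S (fun s => W s * f (W s))
      = ∑ j, p * (1 - p) * cubeExp p S (fun s => M j s * cubeDiff (e j) (fun s => f (W s)) s) := by
    simp only [← cubeExp_centred_mul (he _) (hMe _), ← cubeExp_sum]
    exact cubeExp_congr fun s hs => by rw [← Finset.sum_mul, ← hW s hs]
  have hind : ∀ j, IgnoresCoord (e j) (fun s => M j s * cubeDiff (e j) W s) :=
    fun j => (hMe j).mul ignoresCoord_cubeDiff
  have hlin : ∀ j, cubeExp p S (fun s => M j s * cubeDiff (e j) W s * h (W s))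
      = cubeExp p S (fun s => M j s * cubeDiff (e j) W s *
        (p * h (W (insert (e j) s)) + (1 - p) * h (W (s.erase (e j))))) := by
    intro j
    rw [cubeExp_resample (he j)]
    refine cubeExp_congr fun s _ => ?_
    have h1 := hind j s
    have h2 := (hind j).erase_eq s
    simp only at h1 h2
    rw [h1, h2]
    ring
  have hdiff : |cubeExp p S (fun s => W s * f (W s))
      - cubeExp p S (fun s => (p * (1 - p) * ∑ j, M j s * cubeDiff (e j) W s) * h (W s))|
      ≤ 2 * cubeExp p S
          (fun s => |∑ j, (coordInd (e j) s - p) * (M j s * cubeDiff (e j) W s)|) := by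
    have h1 : cubeExp p S
          (fun s => (p * (1 - p) * ∑ j, M j s * cubeDiff (e j) W s) * h (W s))
        = ∑ j, p * (1 - p) * cubeExp p S (fun s => M j s * cubeDiff (e j) W s *
        (p * h (W (insert (e j) s)) + (1 - p) * h (W (s.erase (e j))))) := by
      simp only [← hlin, ← cubeExp_const_mul, ← cubeExp_sum]
      refine cubeExp_congr fun s _ => ?_
      rw [Finset.mul_sum, Finset.sum_mul]
      exact Finset.sum_congr rfl fun j _ => by ring
    have h2 : ∀ j, |p * (1 - p) * cubeExp p S
          (fun s => M j s * cubeDiff (e j) (fun s => f (W s)) s)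
        - p * (1 - p) * cubeExp p S (fun s => M j s * cubeDiff (e j) W s *
        (p * h (W (insert (e j) s)) + (1 - p) * h (W (s.erase (e j)))))|
        ≤ p * (1 - p) * cubeExp p S (fun s => M j s * cubeDiff (e j) W s *
          cubeDiff (e j) (fun s => r (W s)) s) := by
      intro j
      rw [← mul_sub, abs_mul, abs_of_nonneg hpq, ← cubeExp_sub]
      refine mul_le_mul_of_nonneg_left ((abs_cubeExp_le hp0 hp1).trans
        (cubeExp_mono hp0 hp1 fun s _ => ?_)) hpq
      have h3 := hincr (W (s.erase (e j))) (W (insert (e j) s)) (sub_nonneg.1 (hmono j s))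
      have h4 := mul_le_mul_of_nonneg_left h3 (hM0 j s)
      rw [← abs_of_nonneg (hM0 j s), ← abs_mul, abs_of_nonneg (hM0 j s)] at h4
      simp only [cubeDiff]
      calc _ = _ := by congr 1; ring
        _ ≤ _ := h4
        _ = _ := by ring
    rw [hWf, h1, ← Finset.sum_sub_distrib]
    refine (Finset.abs_sum_le_sum_abs _ _).trans
      ((Finset.sum_le_sum fun j _ => h2 j).trans ?_)
    simp only [← cubeExp_centred_mul (he _) (hind _), ← cubeExp_sum, ← cubeExp_const_mul]
    refine cubeExp_mono hp0 hp1 fun s _ => ?_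
    rw [← Finset.sum_mul]
    refine (le_abs_self _).trans ?_
    rw [abs_mul, mul_comm]
    exact mul_le_mul_of_nonneg_right (hrb _) (abs_nonneg _)
  have hmain : |cubeExp p S (fun s => h (W s))
      - cubeExp p S (fun s => (p * (1 - p) * ∑ j, M j s * cubeDiff (e j) W s) * h (W s))|
      ≤ 2 * cubeExp p S (fun s => |1 - p * (1 - p) * ∑ j, M j s * cubeDiff (e j) W s|) := by
    rw [← cubeExp_sub, ← cubeExp_const_mul]
    refine (abs_cubeExp_le hp0 hp1).trans (cubeExp_mono hp0 hp1 fun s _ => ?_)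
    rw [← one_sub_mul, abs_mul, mul_comm]
    exact mul_le_mul_of_nonneg_right (hhb _) (abs_nonneg _)
  have hstein : cubeExp p S (fun s => if W s ≤ x then 1 else 0) - Φ
      = cubeExp p S (fun s => h (W s)) - cubeExp p S (fun s => W s * f (W s)) := by
    conv_lhs => rw [← cubeExp_const (p := p) (S := S) Φ]
    rw [← cubeExp_sub, ← cubeExp_sub]
    exact cubeExp_congr fun s _ => by simp only [hh]; ring
  rw [hstein]
  rw [abs_le] at hmain hdiff
  rw [abs_le]
  constructor <;> linarith [hmain.1, hmain.2, hdiff.1, hdiff.2]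

end Cube

/-! ### Triangle counts as polynomials in the edge indicators -/

/-- The potential edges of a graph on `V`. -/
def potentialEdges (V : Type*) [Fintype V] [DecidableEq V] : Finset (Sym2 V) :=
  Finset.univ.filter fun e => ¬ e.IsDiag

/-- The vertices different from `i` and `j`. -/
def otherVertices {V : Type*} [Fintype V] [DecidableEq V] (i j : V) : Finset V :=
  Finset.univ.filter fun k => k ≠ i ∧ k ≠ j

/-- The number of common neighbours of `i` and `j` in the graph with edge set `s`. -/
def codegree {V : Type*} [Fintype V] [DecidableEq V] (i j : V) (s : Finset (Sym2 V)) : ℝ :=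
  ∑ k ∈ otherVertices i j, coordInd s(i, k) s * coordInd s(j, k) s

/-- The weight of the centred edge indicator of `ij` in the representation of the centred triangle
count as `∑_{i ≠ j} (x_{ij} - p) M_{ij}`. It comes from the telescoping identity
`x y z - p³ = (x - p) y z + p (y - p) z + p² (z - p)` for each labelled triangle. -/
noncomputable def triangleWeight {V : Type*} [Fintype V] [DecidableEq V] (p : ℝ) (i j : V)
    (s : Finset (Sym2 V)) : ℝ :=
  6⁻¹ * ∑ k ∈ otherVertices i j,
    (coordInd s(i, k) s * coordInd s(j, k) s + p * coordInd s(j, k) s + p ^ 2)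

/-- The sum of `f` over all triples of distinct vertices. -/
def tripleSum {V : Type*} [Fintype V] [DecidableEq V] (f : V → V → V → ℝ) : ℝ :=
  ∑ i, ∑ j, ∑ k, if i ≠ j ∧ k ≠ i ∧ k ≠ j then f i j k else 0

/-- The type of ordered pairs of distinct vertices. -/
abbrev OffDiag (V : Type*) : Type _ := {t : V × V // t.1 ≠ t.2}

/-- The edge joining a pair of distinct vertices. -/
abbrev OffDiag.edge {V : Type*} (j : OffDiag V) : Sym2 V := s(j.1.1, j.1.2)

lemma measurableSingletonClass_simpleGraph (V : Type*) [Finite V] :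
    MeasurableSingletonClass (SimpleGraph V) :=
  ⟨fun G => by
    have : ({G} : Set (SimpleGraph V)) = SimpleGraph.edgeSet ⁻¹' {G.edgeSet} := by
      ext H
      simp
    rw [this]
    exact SimpleGraph.measurable_edgeSet (measurableSet_singleton _)⟩

section Triangles

variable {V : Type*} [DecidableEq V]

lemma card_clique_three_fiber (G : SimpleGraph V) {u : Finset V} (hu : G.IsNClique 3 u) :
    ({t : V × V × V | (G.Adj t.1 t.2.1 ∧ G.Adj t.1 t.2.2 ∧ G.Adj t.2.1 t.2.2) ∧
      ({t.1, t.2.1, t.2.2} : Finset V) = u} : Set (V × V × V)).ncard = 6 := by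
  obtain ⟨a, b, c, hab, hac, hbc, rfl⟩ := SimpleGraph.is3Clique_iff.1 hu
  have hset : ({t : V × V × V | (G.Adj t.1 t.2.1 ∧ G.Adj t.1 t.2.2 ∧ G.Adj t.2.1 t.2.2) ∧
      ({t.1, t.2.1, t.2.2} : Finset V) = {a, b, c}} : Set (V × V × V))
      = (({(a, b, c), (a, c, b), (b, a, c), (b, c, a), (c, a, b), (c, b, a)} :
        Finset (V × V × V)) : Set (V × V × V)) := by
    ext ⟨x, y, z⟩
    simp only [Set.mem_ofPred_eq, Finset.coe_insert, Finset.coe_singleton, Set.mem_insert_iff,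
      Set.mem_singleton_iff, Prod.mk.injEq]
    constructor
    · rintro ⟨⟨hxy, hxz, hyz⟩, h⟩
      have hx : x ∈ ({a, b, c} : Finset V) := h ▸ by simp
      have hy : y ∈ ({a, b, c} : Finset V) := h ▸ by simp
      have hz : z ∈ ({a, b, c} : Finset V) := h ▸ by simp
      simp only [Finset.mem_insert, Finset.mem_singleton] at hx hy hz
      have := hxy.ne
      have := hxz.ne
      have := hyz.ne
      rcases hx with rfl | rfl | rfl <;> rcases hy with rfl | rfl | rfl <;>
        rcases hz with rfl | rfl | rfl <;> simp_all
    · have := hab.symm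
      have := hac.symm
      have := hbc.symm
      rintro (⟨rfl, rfl, rfl⟩ | ⟨rfl, rfl, rfl⟩ | ⟨rfl, rfl, rfl⟩ | ⟨rfl, rfl, rfl⟩ |
        ⟨rfl, rfl, rfl⟩ | ⟨rfl, rfl, rfl⟩) <;>
      refine ⟨⟨by assumption, by assumption, by assumption⟩, ?_⟩ <;>
      · ext w
        simp only [Finset.mem_insert, Finset.mem_singleton]
        try tauto
  rw [hset, Set.ncard_coe_finset]
  have := hab.ne
  have := hac.ne
  have := hbc.ne
  have := hab.ne'
  have := hac.ne'
  have := hbc.ne'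
  rw [Finset.card_insert_of_notMem, Finset.card_insert_of_notMem, Finset.card_insert_of_notMem,
    Finset.card_insert_of_notMem, Finset.card_insert_of_notMem, Finset.card_singleton] <;>
  simp_all

lemma cubeDiff_triangle {e : Sym2 V} {i j k : V} (hij : i ≠ j) (hki : k ≠ i) (hkj : k ≠ j)
    (s : Finset (Sym2 V)) :
    cubeDiff e (fun s => coordInd s(i, j) s * coordInd s(i, k) s * coordInd s(j, k) s) s
      = (if s(i, j) = e then coordInd s(i, k) s * coordInd s(j, k) s else 0)
        + (if s(i, k) = e then coordInd s(i, j) s * coordInd s(j, k) s else 0)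
        + (if s(j, k) = e then coordInd s(i, j) s * coordInd s(i, k) s else 0) := by
  have h1 : s(i, j) ≠ s(i, k) := by simp [hkj.symm, hki.symm]
  have h2 : s(i, j) ≠ s(j, k) := by simp [hij, hkj.symm, hki.symm]
  have h3 : s(i, k) ≠ s(j, k) := by simp [hij, hkj, hki.symm]
  by_cases c1 : s(i, j) = e
  · subst c1
    simp [cubeDiff, coordInd, h1.symm, h2.symm]
  by_cases c2 : s(i, k) = e
  · subst c2
    simp [cubeDiff, coordInd, h1, h3.symm]
  by_cases c3 : s(j, k) = e
  · subst c3
    simp [cubeDiff, coordInd, h2, h3]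
  simp [cubeDiff, coordInd, c1, c2, c3]

variable [Fintype V]

lemma tripleSum_swap_right (f : V → V → V → ℝ) :
    tripleSum f = tripleSum fun i j k => f i k j := by
  unfold tripleSum
  refine Finset.sum_congr rfl fun i _ => ?_
  rw [Finset.sum_comm]
  refine Finset.sum_congr rfl fun j _ => Finset.sum_congr rfl fun k _ => ?_
  congr 1
  apply propext
  constructor <;> rintro ⟨h1, h2, h3⟩ <;> exact ⟨h2.symm, h1.symm, h3.symm⟩

lemma tripleSum_swap_left (f : V → V → V → ℝ) :
    tripleSum f = tripleSum fun i j k => f j i k := by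
  unfold tripleSum
  rw [Finset.sum_comm]
  refine Finset.sum_congr rfl fun i _ => Finset.sum_congr rfl fun j _ =>
    Finset.sum_congr rfl fun k _ => ?_
  congr 1
  apply propext
  constructor <;> rintro ⟨h1, h2, h3⟩ <;> exact ⟨h1.symm, h3, h2⟩

lemma tripleSum_add (f g : V → V → V → ℝ) :
    tripleSum (fun i j k => f i j k + g i j k) = tripleSum f + tripleSum g := by
  simp only [tripleSum, ← Finset.sum_add_distrib]
  refine Finset.sum_congr rfl fun i _ => Finset.sum_congr rfl fun j _ =>
    Finset.sum_congr rfl fun k _ => ?_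
  split_ifs <;> simp

lemma tripleSum_sub (f g : V → V → V → ℝ) :
    tripleSum (fun i j k => f i j k - g i j k) = tripleSum f - tripleSum g := by
  simp only [tripleSum, ← Finset.sum_sub_distrib]
  refine Finset.sum_congr rfl fun i _ => Finset.sum_congr rfl fun j _ =>
    Finset.sum_congr rfl fun k _ => ?_
  split_ifs <;> simp

lemma tripleSum_congr {f g : V → V → V → ℝ}
    (h : ∀ i j k, i ≠ j → k ≠ i → k ≠ j → f i j k = g i j k) : tripleSum f = tripleSum g := by
  refine Finset.sum_congr rfl fun i _ => Finset.sum_congr rfl fun j _ =>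
    Finset.sum_congr rfl fun k _ => ?_
  split_ifs with h'
  · exact h i j k h'.1 h'.2.1 h'.2.2
  · rfl

lemma sum_offDiag (F : V → V → ℝ) :
    ∑ j : OffDiag V, F j.1.1 j.1.2 = ∑ i, ∑ j, if i ≠ j then F i j else 0 := by
  rw [← Finset.sum_product', Finset.univ_product_univ, ← Finset.sum_filter]
  exact (Finset.sum_subtype _ (by simp) (fun t : V × V => F t.1 t.2)).symm

lemma sum_offDiag_sum_otherVertices (f : V → V → V → ℝ) :
    ∑ j : OffDiag V, ∑ k ∈ otherVertices j.1.1 j.1.2, f j.1.1 j.1.2 k = tripleSum f := by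
  rw [sum_offDiag fun i j => ∑ k ∈ otherVertices i j, f i j k]
  refine Finset.sum_congr rfl fun i _ => Finset.sum_congr rfl fun j _ => ?_
  rw [otherVertices, Finset.sum_filter]
  by_cases h : i = j <;> simp [h]

lemma six_mul_ncard_cliqueSet_three (G : SimpleGraph V) :
    6 * (G.cliqueSet 3).ncard
      = ({t : V × V × V | G.Adj t.1 t.2.1 ∧ G.Adj t.1 t.2.2 ∧ G.Adj t.2.1 t.2.2} :
        Set (V × V × V)).ncard := by
  classical
  rw [Set.ncard_eq_toFinset_card' (G.cliqueSet 3),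
    Set.ncard_eq_toFinset_card' ({t : V × V × V | _} : Set (V × V × V)),
    Finset.card_eq_sum_card_fiberwise (f := fun t : V × V × V => ({t.1, t.2.1, t.2.2} : Finset V))
      (t := (G.cliqueSet 3).toFinset)]
  · rw [Finset.sum_congr rfl (g := fun _ => 6), Finset.sum_const, smul_eq_mul, mul_comm]
    intro u hu
    rw [Set.mem_toFinset] at hu
    rw [← card_clique_three_fiber G hu, Set.ncard_eq_toFinset_card']
    congr 1
    ext t
    simp
  · intro t ht
    simp only [Set.coe_toFinset, Set.mem_ofPred_eq] at ht ⊢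
    exact SimpleGraph.is3Clique_iff.2 ⟨_, _, _, ht.1, ht.2.1, ht.2.2, rfl⟩

lemma ncard_cliqueSet_three_eq_tripleSum (s : Finset (Sym2 V)) :
    (((SimpleGraph.fromEdgeSet (s : Set (Sym2 V))).cliqueSet 3).ncard : ℝ)
      = 6⁻¹ * tripleSum fun i j k =>
        coordInd s(i, j) s * coordInd s(i, k) s * coordInd s(j, k) s := by
  classical
  have h := six_mul_ncard_cliqueSet_three (SimpleGraph.fromEdgeSet (s : Set (Sym2 V)))
  have h2 : ((({t : V × V × V | (SimpleGraph.fromEdgeSet (s : Set (Sym2 V))).Adj t.1 t.2.1 ∧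
      (SimpleGraph.fromEdgeSet (s : Set (Sym2 V))).Adj t.1 t.2.2 ∧
      (SimpleGraph.fromEdgeSet (s : Set (Sym2 V))).Adj t.2.1 t.2.2} :
        Set (V × V × V)).ncard : ℕ) : ℝ)
      = tripleSum fun i j k =>
        coordInd s(i, j) s * coordInd s(i, k) s * coordInd s(j, k) s := by
    rw [Set.ncard_eq_toFinset_card', Finset.card_eq_sum_ones, Nat.cast_sum, tripleSum]
    simp only [Nat.cast_one, Set.toFinset_ofPred, Finset.sum_filter]
    rw [← Finset.univ_product_univ, Finset.sum_product]
    refine Finset.sum_congr rfl fun i _ => ?_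
    rw [← Finset.univ_product_univ, Finset.sum_product]
    refine Finset.sum_congr rfl fun j _ => Finset.sum_congr rfl fun k _ => ?_
    simp only [SimpleGraph.fromEdgeSet_adj, Finset.mem_coe, coordInd]
    by_cases h1 : s(i, j) ∈ s <;> by_cases h2 : s(i, k) ∈ s <;> by_cases h3 : s(j, k) ∈ s <;>
      simp [h1, h2, h3, eq_comm]
  rw [← h2, ← h]
  push_cast
  ring

lemma otherVertices_comm (i j : V) : otherVertices i j = otherVertices j i := by
  ext k
  simp [otherVertices, and_comm]

/-- Restricting a sum over triples to those whose first two vertices span the edge `uv`. -/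
lemma tripleSum_ite_edge {u v : V} (huv : u ≠ v) (g : V → V → V → ℝ) :
    tripleSum (fun i j k => if s(i, j) = s(u, v) then g i j k else 0)
      = ∑ k ∈ otherVertices u v, g u v k + ∑ k ∈ otherVertices u v, g v u k := by
  rw [← sum_offDiag_sum_otherVertices]
  have : ∀ j : OffDiag V, ∑ k ∈ otherVertices j.1.1 j.1.2,
        (if s(j.1.1, j.1.2) = s(u, v) then g j.1.1 j.1.2 k else 0)
      = (if j = ⟨(u, v), huv⟩ then ∑ k ∈ otherVertices u v, g u v k else 0)
        + (if j = ⟨(v, u), huv.symm⟩ then ∑ k ∈ otherVertices u v, g v u k else 0) := by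
    rintro ⟨⟨i, j⟩, hij⟩
    simp only [Subtype.mk.injEq, Prod.mk.injEq]
    by_cases h : i = u ∧ j = v
    · obtain ⟨rfl, rfl⟩ := h
      simp [huv]
    · by_cases h' : i = v ∧ j = u
      · obtain ⟨rfl, rfl⟩ := h'
        simp [huv, huv.symm, otherVertices_comm]
      · rw [if_neg h, if_neg h', add_zero]
        refine Finset.sum_eq_zero fun k _ => if_neg ?_
        rw [Sym2.eq_iff]
        tauto
  simp only [this, Finset.sum_add_distrib, Finset.sum_ite_eq', Finset.mem_univ, if_true]

/-- Adding the edge `uv` creates one triangle for each common neighbour of `u` and `v`. -/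
lemma cubeDiff_ncard_cliqueSet_three {u v : V} (huv : u ≠ v) (s : Finset (Sym2 V)) :
    cubeDiff s(u, v) (fun s =>
      (((SimpleGraph.fromEdgeSet (s : Set (Sym2 V))).cliqueSet 3).ncard : ℝ)) s
      = codegree u v s := by
  have hsymm : ∀ i j : V, coordInd s(i, j) s = coordInd s(j, i) s := fun i j => by
    rw [Sym2.eq_swap]
  have h1 : cubeDiff s(u, v) (fun s =>
      (((SimpleGraph.fromEdgeSet (s : Set (Sym2 V))).cliqueSet 3).ncard : ℝ)) s
      = 6⁻¹ * tripleSum fun i j k =>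
        (if s(i, j) = s(u, v) then coordInd s(i, k) s * coordInd s(j, k) s else 0)
        + (if s(i, k) = s(u, v) then coordInd s(i, j) s * coordInd s(j, k) s else 0)
        + (if s(j, k) = s(u, v) then coordInd s(i, j) s * coordInd s(i, k) s else 0) := by
    rw [cubeDiff, ncard_cliqueSet_three_eq_tripleSum, ncard_cliqueSet_three_eq_tripleSum,
      ← mul_sub, ← tripleSum_sub]
    congr 1
    exact tripleSum_congr fun i j k hij hki hkj => cubeDiff_triangle hij hki hkj s
  set g : V → V → V → ℝ := fun i j k =>
    if s(i, j) = s(u, v) then coordInd s(i, k) s * coordInd s(j, k) s else 0 with hg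
  have h2 : tripleSum (fun i j k =>
      if s(i, k) = s(u, v) then coordInd s(i, j) s * coordInd s(j, k) s else 0)
      = tripleSum g := by
    rw [tripleSum_swap_right]
    exact tripleSum_congr fun i j k _ _ _ => by simp only [hg, hsymm k j]
  have h3 : tripleSum (fun i j k =>
      if s(j, k) = s(u, v) then coordInd s(i, j) s * coordInd s(i, k) s else 0)
      = tripleSum g := by
    rw [tripleSum_swap_left, ← h2]
    exact tripleSum_congr fun i j k _ _ _ => by simp only [hsymm j i]
  have h4 : tripleSum g = 2 * codegree u v s := by
    rw [hg, tripleSum_ite_edge huv fun i j k => coordInd s(i, k) s * coordInd s(j, k) s]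
    simp only [codegree, two_mul]
    congr 1
    exact Finset.sum_congr rfl fun k _ => mul_comm _ _
  rw [h1, tripleSum_add, tripleSum_add, h2, h3, h4]
  ring

/-- The centred triangle count as a sum of centred edge indicators with weights. -/
lemma ncard_cliqueSet_three_sub (p : ℝ) (s : Finset (Sym2 V)) :
    (((SimpleGraph.fromEdgeSet (s : Set (Sym2 V))).cliqueSet 3).ncard : ℝ)
        - 6⁻¹ * tripleSum (fun _ _ _ : V => p ^ 3)
      = ∑ j : OffDiag V, (coordInd j.edge s - p) * triangleWeight p j.1.1 j.1.2 s := by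
  have hsymm : ∀ i j : V, coordInd s(i, j) s = coordInd s(j, i) s := fun i j => by
    rw [Sym2.eq_swap]
  have h1 : ∑ j : OffDiag V, (coordInd j.edge s - p) * triangleWeight p j.1.1 j.1.2 s
      = 6⁻¹ * tripleSum fun i j k => (coordInd s(i, j) s - p) *
        (coordInd s(i, k) s * coordInd s(j, k) s + p * coordInd s(j, k) s + p ^ 2) := by
    rw [← sum_offDiag_sum_otherVertices, Finset.mul_sum]
    refine Finset.sum_congr rfl fun j _ => ?_
    rw [triangleWeight, ← Finset.mul_sum]
    ring
  have h2 : tripleSum (fun i j k : V => p * (coordInd s(i, j) s - p) * coordInd s(j, k) s)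
      = tripleSum fun i j k : V => p * (coordInd s(i, k) s - p) * coordInd s(j, k) s := by
    rw [tripleSum_swap_right]
    exact tripleSum_congr fun i j k _ _ _ => by rw [hsymm k j]
  have h3 : tripleSum (fun i j _ : V => p ^ 2 * (coordInd s(i, j) s - p))
      = tripleSum fun _ j k : V => p ^ 2 * (coordInd s(j, k) s - p) := by
    rw [tripleSum_swap_right, tripleSum_swap_left]
  rw [h1, ncard_cliqueSet_three_eq_tripleSum, ← mul_sub, ← tripleSum_sub]
  congr 1
  have h4 : tripleSum (fun i j k => (coordInd s(i, j) s - p) *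
        (coordInd s(i, k) s * coordInd s(j, k) s + p * coordInd s(j, k) s + p ^ 2))
      = tripleSum (fun i j k => (coordInd s(i, j) s - p) * coordInd s(i, k) s * coordInd s(j, k) s)
        + tripleSum (fun i j k : V => p * (coordInd s(i, j) s - p) * coordInd s(j, k) s)
        + tripleSum (fun i j _ : V => p ^ 2 * (coordInd s(i, j) s - p)) := by
    rw [← tripleSum_add, ← tripleSum_add]
    exact tripleSum_congr fun i j k _ _ _ => by ring
  rw [h4, h2, h3, ← tripleSum_add, ← tripleSum_add]
  exact tripleSum_congr fun i j k _ _ _ => by ring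

lemma mem_potentialEdges {e : Sym2 V} : e ∈ potentialEdges V ↔ ¬ e.IsDiag := by
  simp [potentialEdges]

lemma OffDiag.edge_mem (j : OffDiag V) : j.edge ∈ potentialEdges V := by
  rw [mem_potentialEdges]
  exact j.2

lemma fromEdgeSet_edgeSet_of_subset {s : Finset (Sym2 V)} (hs : s ⊆ potentialEdges V) :
    (SimpleGraph.fromEdgeSet (s : Set (Sym2 V))).edgeSet = s := by
  rw [SimpleGraph.edgeSet_fromEdgeSet]
  ext e
  simp only [Set.mem_sdiff, Finset.mem_coe]
  exact ⟨fun h => h.1, fun h => ⟨h, mem_potentialEdges.1 (hs h)⟩⟩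

/-- Integrals over the random graph are expectations over random subsets of the edges. -/
lemma integral_binomialRandom (p : unitInterval) (F : SimpleGraph V → ℝ) :
    ∫ G, F G ∂(SimpleGraph.binomialRandom V p)
      = cubeExp (p : ℝ) (potentialEdges V)
        (fun s => F (SimpleGraph.fromEdgeSet (s : Set (Sym2 V)))) := by
  classical
  have := measurableSingletonClass_simpleGraph V
  rw [integral_fintype (Integrable.of_finite), cubeExp]
  symm
  refine Finset.sum_bij' (fun s _ => SimpleGraph.fromEdgeSet (s : Set (Sym2 V)))
    (fun G _ => G.edgeFinset) (fun _ _ => Finset.mem_univ _) ?_ ?_ ?_ ?_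
  · intro G _
    rw [Finset.mem_powerset]
    intro e he
    rw [mem_potentialEdges]
    exact G.not_isDiag_of_mem_edgeFinset he
  · intro s hs
    refine Finset.coe_injective ?_
    rw [SimpleGraph.coe_edgeFinset, fromEdgeSet_edgeSet_of_subset (Finset.mem_powerset.1 hs)]
  · intro G _
    simp
  · intro s hs
    rw [Finset.mem_powerset] at hs
    have hcard : (potentialEdges V).card = (Nat.card V).choose 2 := by
      rw [Nat.card_eq_fintype_card, ← Sym2.card_subtype_not_diag, Fintype.card_subtype,
        potentialEdges]
    rw [measureReal_def, SimpleGraph.binomialRandom_singleton, fromEdgeSet_edgeSet_of_subset hs,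
      Set.ncard_coe_finset, Finset.card_sdiff_of_subset hs, hcard, smul_eq_mul]
    simp

end Triangles

/-! ### Moment estimates -/

section GrowthBounds

variable {α : Type*} [DecidableEq α] {p : ℝ} {S : Finset α} {e e' : α} {F : Finset α → ℝ}

/-- Conditioning on one coordinate: if adding `e` to the set increases `F` by at most a factor
`c`, then a factor `coordInd e + p` inside the expectation costs at most `(c + 1) p`. -/
lemma cubeExp_coordInd_add_mul_le (hp0 : 0 ≤ p) (hp1 : p ≤ 1) (he : e ∈ S) {c : ℝ}
    (hF : ∀ s, F (insert e s) ≤ c * F s) :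
    cubeExp p S (fun s => (coordInd e s + p) * F s) ≤ (c + 1) * p * cubeExp p S F := by
  simp only [add_mul, cubeExp_add]
  rw [cubeExp_coordInd_mul he, cubeExp_const_mul]
  have h : cubeExp p S (fun s => F (insert e s)) ≤ c * cubeExp p S F := by
    rw [← cubeExp_const_mul]
    exact cubeExp_mono hp0 hp1 fun s _ => hF s
  nlinarith [mul_le_mul_of_nonneg_left h hp0]

lemma cubeExp_coordInd_add_mul_mul_le (hp0 : 0 ≤ p) (hp1 : p ≤ 1) (he : e ∈ S) (he' : e' ∈ S)
    (hee' : e ≠ e') {c : ℝ} (hc : 0 ≤ c) (hF : ∀ a s, F (insert a s) ≤ c * F s) :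
    cubeExp p S (fun s => (coordInd e s + p) * (coordInd e' s + p) * F s)
      ≤ ((c + 1) * p) ^ 2 * cubeExp p S F := by
  have h1 := cubeExp_coordInd_add_mul_le (F := fun s => (coordInd e' s + p) * F s) hp0 hp1 he
    (c := c) fun s => by
      rw [ignoresCoord_coordInd hee' s]
      have := mul_le_mul_of_nonneg_left (hF e s)
        (add_nonneg (coordInd_nonneg (e := e') s) hp0)
      linarith
  have h2 := cubeExp_coordInd_add_mul_le hp0 hp1 he' (hF e')
  have h3 := mul_le_mul_of_nonneg_left h2 (by positivity : 0 ≤ (c + 1) * p)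
  simp only [← mul_assoc] at h1 h3 ⊢
  calc _ ≤ _ := h1
    _ ≤ _ := h3
    _ = _ := by ring

lemma coordInd_insert_le (a : α) (s : Finset α) :
    coordInd e (insert a s) ≤ coordInd e s + if e = a then 1 else 0 := by
  by_cases h : e = a
  · rw [if_pos h]
    linarith [coordInd_le_one (e := e) (insert a s), coordInd_nonneg (e := e) s]
  · simp [coordInd, h]

lemma coordInd_mono {s t : Finset α} (h : s ⊆ t) : coordInd e s ≤ coordInd e t := by
  by_cases h' : e ∈ s
  · simp [coordInd, h', h h']
  · simp only [coordInd, h', if_false]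
    split_ifs <;> norm_num

lemma cubeDiff_coordInd (a e : α) (s : Finset α) :
    cubeDiff a (coordInd e) s = if e = a then 1 else 0 := by
  by_cases h : e = a
  · simp [cubeDiff, coordInd, h]
  · simp [cubeDiff, coordInd, h]

lemma cubeDiff_coordInd_mul (hee' : e ≠ e') (a : α) (s : Finset α) :
    cubeDiff a (fun s => coordInd e s * coordInd e' s) s
      = (if e = a then 1 else 0) * coordInd e' s + (if e' = a then 1 else 0) * coordInd e s := by
  by_cases h : e = a
  · subst h
    simp [cubeDiff, coordInd, hee'.symm]
  by_cases h' : e' = a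
  · subst h'
    simp [cubeDiff, coordInd, hee']
  simp [cubeDiff, coordInd, h, h']

end GrowthBounds

lemma sum_ite_edge_le_one {V : Type*} [DecidableEq V] (t : Finset V) (i : V) (a : Sym2 V) :
    ∑ k ∈ t, (if s(i, k) = a then (1 : ℝ) else 0) ≤ 1 := by
  rw [Finset.sum_boole]
  have : (t.filter fun k => s(i, k) = a).card ≤ 1 := by
    rw [Finset.card_le_one]
    intro x hx y hy
    have := ((Finset.mem_filter.1 hx).2).trans ((Finset.mem_filter.1 hy).2).symm
    exact Sym2.congr_right.1 this
  exact_mod_cast this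

lemma ncard_edge_eq_le_two {V : Type*} (a : OffDiag V) : {b : OffDiag V | b.edge = a.edge}.ncard ≤ 2 := by
  have h : {b : OffDiag V | b.edge = a.edge}
      ⊆ {a, ⟨(a.1.2, a.1.1), a.2.symm⟩} := by
    rintro ⟨⟨u, v⟩, huv⟩ hb
    simp only [Set.mem_ofPred_eq, Sym2.eq_iff] at hb
    rcases hb with ⟨rfl, rfl⟩ | ⟨rfl, rfl⟩
    · left; rfl
    · right; rfl
  exact (Set.ncard_le_ncard h (Set.toFinite _)).trans (Set.ncard_insert_le _ _ |>.trans (by simp))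

/-- A weighted count of paths of length two from `i` to `j`; it dominates the codegree and the
weight `triangleWeight`, and it grows by at most a constant factor when an edge is added. -/
def pathCount {V : Type*} [Fintype V] [DecidableEq V] (p : ℝ) (i j : V)
    (s : Finset (Sym2 V)) : ℝ :=
  1 + ∑ k ∈ otherVertices i j, (coordInd s(i, k) s + p) * (coordInd s(j, k) s + p)

/-- A bound for the effect of the edge `a` on `codegree i j` and `triangleWeight p i j`. -/
def edgeInfluence {V : Type*} [Fintype V] [DecidableEq V] (p : ℝ) (i j : V) (a : Sym2 V)
    (s : Finset (Sym2 V)) : ℝ :=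
  ∑ k ∈ otherVertices i j, ((if s(i, k) = a then 1 else 0) * (coordInd s(j, k) s + p)
    + (if s(j, k) = a then 1 else 0) * (coordInd s(i, k) s + p))

section Moments

variable {V : Type*} [Fintype V] [DecidableEq V] {p : ℝ} {i j : V}

lemma card_otherVertices (hij : i ≠ j) :
    ((otherVertices i j).card : ℝ) = (Fintype.card V : ℝ) - 2 := by
  have h : otherVertices i j = Finset.univ \ {i, j} := by
    ext k
    simp [otherVertices]
  have h2 := Finset.card_sdiff_add_card_eq_card (Finset.subset_univ ({i, j} : Finset V))
  rw [Finset.card_pair hij, Finset.card_univ] at h2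
  rw [h, ← h2]
  push_cast
  ring

lemma edge_mem_left {k : V} (hk : k ∈ otherVertices i j) : s(i, k) ∈ potentialEdges V := by
  rw [mem_potentialEdges]
  exact (Finset.mem_filter.1 hk).2.1.symm

lemma edge_mem_right {k : V} (hk : k ∈ otherVertices i j) : s(j, k) ∈ potentialEdges V := by
  rw [mem_potentialEdges]
  exact (Finset.mem_filter.1 hk).2.2.symm

lemma edge_ne (hij : i ≠ j) {k : V} (hk : k ∈ otherVertices i j) : s(i, k) ≠ s(j, k) := by
  have := (Finset.mem_filter.1 hk).2
  simp [hij, this.1.symm]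

lemma edge_ne_left {k : V} (hk : k ∈ otherVertices i j) : s(i, j) ≠ s(i, k) := by
  have := (Finset.mem_filter.1 hk).2
  simp [this.2.symm, this.1.symm]

lemma edge_ne_right {k : V} (hk : k ∈ otherVertices i j) : s(i, j) ≠ s(j, k) := by
  have := (Finset.mem_filter.1 hk).2
  simp [this.2.symm, this.1.symm]

lemma one_le_pathCount (hp0 : 0 ≤ p) (s : Finset (Sym2 V)) : 1 ≤ pathCount p i j s := by
  refine le_add_of_nonneg_right (Finset.sum_nonneg fun k _ => ?_)
  exact mul_nonneg (add_nonneg (coordInd_nonneg s) hp0) (add_nonneg (coordInd_nonneg s) hp0)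

lemma pathCount_mono (hp0 : 0 ≤ p) {s t : Finset (Sym2 V)} (h : s ⊆ t) :
    pathCount p i j s ≤ pathCount p i j t := by
  refine add_le_add le_rfl (Finset.sum_le_sum fun k _ => ?_)
  exact mul_le_mul (add_le_add (coordInd_mono h) le_rfl) (add_le_add (coordInd_mono h) le_rfl)
    (add_nonneg (coordInd_nonneg s) hp0) (add_nonneg (coordInd_nonneg t) hp0)

lemma pathCount_comm (s : Finset (Sym2 V)) : pathCount p i j s = pathCount p j i s := by
  rw [pathCount, pathCount, otherVertices_comm]
  congr 1
  exact Finset.sum_congr rfl fun k _ => mul_comm _ _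

lemma pathCount_insert_le (hp0 : 0 ≤ p) (hp1 : p ≤ 1) (a : Sym2 V) (s : Finset (Sym2 V)) :
    pathCount p i j (insert a s) ≤ 6 * pathCount p i j s := by
  have h : pathCount p i j (insert a s) ≤ pathCount p i j s
      + (3 * ∑ k ∈ otherVertices i j, (if s(i, k) = a then (1 : ℝ) else 0)
        + 2 * ∑ k ∈ otherVertices i j, (if s(j, k) = a then (1 : ℝ) else 0)) := by
    rw [pathCount, pathCount, add_assoc]
    refine add_le_add le_rfl ?_
    rw [Finset.mul_sum, Finset.mul_sum, ← Finset.sum_add_distrib, ← Finset.sum_add_distrib]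
    refine Finset.sum_le_sum fun k _ => ?_
    have h1 := coordInd_insert_le (e := s(i, k)) a s
    have h2 := coordInd_insert_le (e := s(j, k)) a s
    have h3 := coordInd_nonneg (e := s(i, k)) s
    have h4 := coordInd_nonneg (e := s(j, k)) s
    have h5 := coordInd_le_one (e := s(i, k)) s
    have h6 := coordInd_le_one (e := s(j, k)) s
    have h7 := coordInd_nonneg (e := s(i, k)) (insert a s)
    have h8 := coordInd_nonneg (e := s(j, k)) (insert a s)
    refine (mul_le_mul (add_le_add h1 le_rfl) (add_le_add h2 le_rfl) (add_nonneg h8 hp0)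
      (add_nonneg (h7.trans h1) hp0)).trans ?_
    split_ifs <;> nlinarith
  have h1 := sum_ite_edge_le_one (otherVertices i j) i a
  have h2 := sum_ite_edge_le_one (otherVertices i j) j a
  have h3 := one_le_pathCount (i := i) (j := j) hp0 s
  linarith

lemma pathCount_pow_insert_le (hp0 : 0 ≤ p) (hp1 : p ≤ 1) (m : ℕ) (a : Sym2 V)
    (s : Finset (Sym2 V)) :
    pathCount p i j (insert a s) ^ m ≤ 6 ^ m * pathCount p i j s ^ m := by
  rw [← mul_pow]
  exact pow_le_pow_left₀ (zero_le_one.trans (one_le_pathCount hp0 _))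
    (pathCount_insert_le hp0 hp1 a s) m

lemma cubeExp_path_mul_pathCount_pow_le (hp0 : 0 ≤ p) (hp1 : p ≤ 1) (hij : i ≠ j) (m : ℕ) :
    cubeExp p (potentialEdges V) (fun s => (∑ k ∈ otherVertices i j,
        (coordInd s(i, k) s + p) * (coordInd s(j, k) s + p)) * pathCount p i j s ^ m)
      ≤ (6 ^ m + 1) ^ 2 * (((Fintype.card V : ℝ) - 2) * p ^ 2)
        * cubeExp p (potentialEdges V) (fun s => pathCount p i j s ^ m) := by
  simp only [Finset.sum_mul, cubeExp_sum]
  refine (Finset.sum_le_sum fun k hk => cubeExp_coordInd_add_mul_mul_le hp0 hp1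
    (edge_mem_left hk) (edge_mem_right hk) (edge_ne hij hk) (by positivity)
    (pathCount_pow_insert_le (i := i) (j := j) hp0 hp1 m)).trans_eq ?_
  rw [Finset.sum_const, nsmul_eq_mul, card_otherVertices hij]
  ring

lemma cubeExp_pathCount_pow_succ_le (hp0 : 0 ≤ p) (hp1 : p ≤ 1) (hij : i ≠ j) (m : ℕ) :
    cubeExp p (potentialEdges V) (fun s => pathCount p i j s ^ (m + 1))
      ≤ (6 ^ m + 1) ^ 2 * (1 + ((Fintype.card V : ℝ) - 2) * p ^ 2)
        * cubeExp p (potentialEdges V) (fun s => pathCount p i j s ^ m) := by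
  have h := cubeExp_path_mul_pathCount_pow_le hp0 hp1 hij m
  have h0 : 0 ≤ cubeExp p (potentialEdges V) (fun s => pathCount p i j s ^ m) :=
    cubeExp_nonneg hp0 hp1 fun s _ =>
      pow_nonneg (zero_le_one.trans (one_le_pathCount hp0 _)) m
  have h1 : cubeExp p (potentialEdges V) (fun s => pathCount p i j s ^ (m + 1))
      = cubeExp p (potentialEdges V) (fun s => pathCount p i j s ^ m)
        + cubeExp p (potentialEdges V) (fun s => (∑ k ∈ otherVertices i j,
        (coordInd s(i, k) s + p) * (coordInd s(j, k) s + p)) * pathCount p i j s ^ m) := by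
    rw [← cubeExp_add]
    refine cubeExp_congr fun s _ => ?_
    rw [pow_succ]
    conv_lhs => enter [2]; rw [pathCount]
    ring
  have h2 : (1 : ℝ) ≤ (6 ^ m + 1) ^ 2 := by
    have : (0 : ℝ) ≤ 6 ^ m := by positivity
    nlinarith
  rw [h1]
  nlinarith

lemma card_sub_two_nonneg (hij : i ≠ j) : 0 ≤ (Fintype.card V : ℝ) - 2 := by
  rw [← card_otherVertices hij]
  positivity

lemma cubeExp_pathCount_sq_le (hp0 : 0 ≤ p) (hp1 : p ≤ 1) (hij : i ≠ j) :
    cubeExp p (potentialEdges V) (fun s => pathCount p i j s ^ 2)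
      ≤ 196 * (1 + ((Fintype.card V : ℝ) - 2) * p ^ 2) ^ 2 := by
  have h0 := cubeExp_pathCount_pow_succ_le hp0 hp1 hij 0
  have h1 := cubeExp_pathCount_pow_succ_le hp0 hp1 hij 1
  simp only [pow_zero, cubeExp_const] at h0
  have hn := card_sub_two_nonneg hij
  have hμ : 0 ≤ 1 + ((Fintype.card V : ℝ) - 2) * p ^ 2 := by positivity
  norm_num at h0 h1
  refine h1.trans ((mul_le_mul_of_nonneg_left h0 (by positivity)).trans_eq ?_)
  ring

lemma cubeExp_pathCount_cube_le (hp0 : 0 ≤ p) (hp1 : p ≤ 1) (hij : i ≠ j) :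
    cubeExp p (potentialEdges V) (fun s => pathCount p i j s ^ 3)
      ≤ 268324 * (1 + ((Fintype.card V : ℝ) - 2) * p ^ 2) ^ 3 := by
  have h0 := cubeExp_pathCount_sq_le hp0 hp1 hij
  have h1 := cubeExp_pathCount_pow_succ_le hp0 hp1 hij 2
  have hn := card_sub_two_nonneg hij
  have hμ : 0 ≤ 1 + ((Fintype.card V : ℝ) - 2) * p ^ 2 := by positivity
  norm_num at h1
  refine h1.trans ((mul_le_mul_of_nonneg_left h0 (by positivity)).trans_eq ?_)
  ring

lemma codegree_nonneg (s : Finset (Sym2 V)) : 0 ≤ codegree i j s :=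
  Finset.sum_nonneg fun _ _ => mul_nonneg (coordInd_nonneg s) (coordInd_nonneg s)

lemma codegree_le (hp0 : 0 ≤ p) (s : Finset (Sym2 V)) :
    codegree i j s ≤ ∑ k ∈ otherVertices i j,
      (coordInd s(i, k) s + p) * (coordInd s(j, k) s + p) := by
  refine Finset.sum_le_sum fun k _ => ?_
  have h1 := coordInd_nonneg (e := s(i, k)) s
  have h2 := coordInd_nonneg (e := s(j, k)) s
  nlinarith [mul_nonneg h1 hp0, mul_nonneg h2 hp0]

lemma codegree_le_pathCount (hp0 : 0 ≤ p) (s : Finset (Sym2 V)) :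
    codegree i j s ≤ pathCount p i j s :=
  (codegree_le hp0 s).trans (le_add_of_nonneg_left zero_le_one)

lemma triangleWeight_nonneg (hp0 : 0 ≤ p) (s : Finset (Sym2 V)) :
    0 ≤ triangleWeight p i j s := by
  refine mul_nonneg (by norm_num) (Finset.sum_nonneg fun k _ => ?_)
  have h1 := coordInd_nonneg (e := s(i, k)) s
  have h2 := coordInd_nonneg (e := s(j, k)) s
  positivity

lemma triangleWeight_le_pathCount (hp0 : 0 ≤ p) (s : Finset (Sym2 V)) :
    triangleWeight p i j s ≤ pathCount p i j s := by
  have h : ∑ k ∈ otherVertices i j,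
      (coordInd s(i, k) s * coordInd s(j, k) s + p * coordInd s(j, k) s + p ^ 2)
      ≤ ∑ k ∈ otherVertices i j, (coordInd s(i, k) s + p) * (coordInd s(j, k) s + p) := by
    refine Finset.sum_le_sum fun k _ => ?_
    nlinarith [mul_nonneg (coordInd_nonneg (e := s(i, k)) s) hp0]
  have h0 := triangleWeight_nonneg (i := i) (j := j) hp0 s
  rw [triangleWeight] at h0 ⊢
  rw [pathCount]
  linarith

lemma ignoresCoord_codegree : IgnoresCoord s(i, j) (codegree i j) := fun s =>
  Finset.sum_congr rfl fun k hk => by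
    rw [ignoresCoord_coordInd (edge_ne_left hk) s, ignoresCoord_coordInd (edge_ne_right hk) s]

lemma ignoresCoord_triangleWeight : IgnoresCoord s(i, j) (triangleWeight p i j) := fun s => by
  rw [triangleWeight, triangleWeight]
  congr 1
  exact Finset.sum_congr rfl fun k hk => by
    rw [ignoresCoord_coordInd (edge_ne_left hk) s, ignoresCoord_coordInd (edge_ne_right hk) s]

lemma cubeExp_sq_triangleWeight_mul_codegree_le (hp0 : 0 ≤ p) (hp1 : p ≤ 1) (hij : i ≠ j) :
    cubeExp p (potentialEdges V) (fun s => (triangleWeight p i j s * codegree i j s) ^ 2)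
      ≤ 217 ^ 2 * 268324 * (((Fintype.card V : ℝ) - 2) * p ^ 2)
        * (1 + ((Fintype.card V : ℝ) - 2) * p ^ 2) ^ 3 := by
  have hn := card_sub_two_nonneg hij
  have h1 := cubeExp_path_mul_pathCount_pow_le hp0 hp1 hij 3
  have h2 := cubeExp_pathCount_cube_le hp0 hp1 hij
  have h3 : cubeExp p (potentialEdges V)
        (fun s => (triangleWeight p i j s * codegree i j s) ^ 2)
      ≤ cubeExp p (potentialEdges V) (fun s => (∑ k ∈ otherVertices i j,
        (coordInd s(i, k) s + p) * (coordInd s(j, k) s + p)) * pathCount p i j s ^ 3) := by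
    refine cubeExp_mono hp0 hp1 fun s _ => ?_
    have hM0 := triangleWeight_nonneg (i := i) (j := j) hp0 s
    have hM := triangleWeight_le_pathCount (i := i) (j := j) hp0 s
    have hN0 := codegree_nonneg (i := i) (j := j) s
    have hN := codegree_le_pathCount (i := i) (j := j) hp0 s
    have hN' := codegree_le (i := i) (j := j) hp0 s
    have hK0 := hM0.trans hM
    have hP0 := hN0.trans hN'
    calc (triangleWeight p i j s * codegree i j s) ^ 2
        = codegree i j s * (triangleWeight p i j s ^ 2 * codegree i j s) := by ring
      _ ≤ (∑ k ∈ otherVertices i j, (coordInd s(i, k) s + p) * (coordInd s(j, k) s + p))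
          * (pathCount p i j s ^ 2 * pathCount p i j s) := by gcongr
      _ = _ := by ring
  norm_num at h1
  refine h3.trans (h1.trans ((mul_le_mul_of_nonneg_left h2 (by positivity)).trans_eq ?_))
  ring

/-! ### The effect of one edge -/

lemma edgeInfluence_nonneg (hp0 : 0 ≤ p) (a : Sym2 V) (s : Finset (Sym2 V)) :
    0 ≤ edgeInfluence p i j a s := by
  refine Finset.sum_nonneg fun k _ => ?_
  have h1 := coordInd_nonneg (e := s(i, k)) s
  have h2 := coordInd_nonneg (e := s(j, k)) s
  split_ifs <;> positivity

lemma edgeInfluence_le_four (hp1 : p ≤ 1) (a : Sym2 V) (s : Finset (Sym2 V)) :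
    edgeInfluence p i j a s ≤ 4 := by
  have h : edgeInfluence p i j a s
      ≤ 2 * ∑ k ∈ otherVertices i j, (if s(i, k) = a then (1 : ℝ) else 0)
        + 2 * ∑ k ∈ otherVertices i j, (if s(j, k) = a then (1 : ℝ) else 0) := by
    rw [edgeInfluence, Finset.mul_sum, Finset.mul_sum, ← Finset.sum_add_distrib]
    refine Finset.sum_le_sum fun k _ => ?_
    have h5 := coordInd_le_one (e := s(i, k)) s
    have h6 := coordInd_le_one (e := s(j, k)) s
    split_ifs <;> linarith
  have h1 := sum_ite_edge_le_one (otherVertices i j) i a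
  have h2 := sum_ite_edge_le_one (otherVertices i j) j a
  linarith

lemma cubeDiff_codegree (hij : i ≠ j) (a : Sym2 V) (s : Finset (Sym2 V)) :
    cubeDiff a (codegree i j) s = ∑ k ∈ otherVertices i j,
      ((if s(i, k) = a then 1 else 0) * coordInd s(j, k) s
        + (if s(j, k) = a then 1 else 0) * coordInd s(i, k) s) := by
  rw [cubeDiff, codegree, codegree, ← Finset.sum_sub_distrib]
  exact Finset.sum_congr rfl fun k hk => cubeDiff_coordInd_mul (edge_ne hij hk) a s

lemma cubeDiff_triangleWeight (hij : i ≠ j) (a : Sym2 V) (s : Finset (Sym2 V)) :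
    cubeDiff a (triangleWeight p i j) s = 6⁻¹ * ∑ k ∈ otherVertices i j,
      ((if s(i, k) = a then 1 else 0) * coordInd s(j, k) s
        + (if s(j, k) = a then 1 else 0) * (coordInd s(i, k) s + p)) := by
  rw [cubeDiff, triangleWeight, triangleWeight, ← mul_sub, ← Finset.sum_sub_distrib]
  congr 1
  refine Finset.sum_congr rfl fun k hk => ?_
  have h1 := cubeDiff_coordInd_mul (edge_ne hij hk) a s
  have h2 := cubeDiff_coordInd a s(j, k) s
  rw [cubeDiff] at h1 h2
  linear_combination h1 + p * h2

lemma cubeDiff_codegree_bounds (hp0 : 0 ≤ p) (hij : i ≠ j) (a : Sym2 V)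
    (s : Finset (Sym2 V)) :
    0 ≤ cubeDiff a (codegree i j) s ∧
      cubeDiff a (codegree i j) s ≤ edgeInfluence p i j a s := by
  rw [cubeDiff_codegree hij]
  constructor
  · refine Finset.sum_nonneg fun k _ => ?_
    have h1 := coordInd_nonneg (e := s(i, k)) s
    have h2 := coordInd_nonneg (e := s(j, k)) s
    split_ifs <;> positivity
  · refine Finset.sum_le_sum fun k _ => ?_
    split_ifs <;> linarith

lemma cubeDiff_triangleWeight_bounds (hp0 : 0 ≤ p) (hij : i ≠ j) (a : Sym2 V)
    (s : Finset (Sym2 V)) :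
    0 ≤ cubeDiff a (triangleWeight p i j) s ∧
      cubeDiff a (triangleWeight p i j) s ≤ edgeInfluence p i j a s := by
  have h0 : 0 ≤ ∑ k ∈ otherVertices i j,
      ((if s(i, k) = a then 1 else 0) * coordInd s(j, k) s
        + (if s(j, k) = a then 1 else 0) * (coordInd s(i, k) s + p)) := by
    refine Finset.sum_nonneg fun k _ => ?_
    have h1 := coordInd_nonneg (e := s(i, k)) s
    have h2 := coordInd_nonneg (e := s(j, k)) s
    split_ifs <;> positivity
  have h1 : ∑ k ∈ otherVertices i j,
      ((if s(i, k) = a then 1 else 0) * coordInd s(j, k) s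
        + (if s(j, k) = a then 1 else 0) * (coordInd s(i, k) s + p))
      ≤ edgeInfluence p i j a s := by
    refine Finset.sum_le_sum fun k _ => ?_
    split_ifs <;> linarith
  rw [cubeDiff_triangleWeight hij]
  constructor <;> linarith

lemma cubeDiff_triangleWeight_mul_codegree_bounds (hp0 : 0 ≤ p) (hp1 : p ≤ 1) (hij : i ≠ j)
    (a : Sym2 V) (s : Finset (Sym2 V)) :
    0 ≤ cubeDiff a (fun s => triangleWeight p i j s * codegree i j s) s ∧
      cubeDiff a (fun s => triangleWeight p i j s * codegree i j s) s
        ≤ 7 * (pathCount p i j s * edgeInfluence p i j a s) := by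
  obtain ⟨hN0, hN⟩ := cubeDiff_codegree_bounds hp0 hij a s
  obtain ⟨hM0, hM⟩ := cubeDiff_triangleWeight_bounds hp0 hij a s
  have hsplit : cubeDiff a (fun s => triangleWeight p i j s * codegree i j s) s
      = triangleWeight p i j (insert a s) * cubeDiff a (codegree i j) s
        + codegree i j (s.erase a) * cubeDiff a (triangleWeight p i j) s := by
    simp only [cubeDiff]
    ring
  have h1 := triangleWeight_nonneg (i := i) (j := j) hp0 (insert a s)
  have h2 := codegree_nonneg (i := i) (j := j) (s.erase a)
  have h3 := (triangleWeight_le_pathCount (i := i) (j := j) hp0 (insert a s)).trans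
    (pathCount_insert_le hp0 hp1 a s)
  have h4 := (codegree_le_pathCount (i := i) (j := j) hp0 (s.erase a)).trans
    (pathCount_mono hp0 (Finset.erase_subset a s))
  have h5 := mul_le_mul h3 hN hN0 (h1.trans h3)
  have h6 := mul_le_mul h4 hM hM0 (h2.trans h4)
  rw [hsplit]
  constructor
  · positivity
  · linarith

lemma sum_ite_eq_edge_le_two {e : Sym2 V} :
    ∑ b : OffDiag V, (if e = b.edge then (1 : ℝ) else 0) ≤ 2 := by
  rw [Finset.sum_boole]
  by_cases h : ∃ a : OffDiag V, a.edge = e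
  · obtain ⟨a, rfl⟩ := h
    have := ncard_edge_eq_le_two a
    rw [Set.ncard_eq_toFinset_card', Set.toFinset_ofPred] at this
    simp only [eq_comm (a := a.edge)]
    exact_mod_cast this
  · rw [Finset.filter_false_of_mem]
    · simp
    · exact fun b _ hb => h ⟨b, hb.symm⟩

lemma card_otherVertices_le (hij : i ≠ j) :
    ((otherVertices i j).card : ℝ) ≤ Fintype.card V := by
  rw [card_otherVertices hij]
  linarith

lemma sum_cubeExp_sq_cubeDiff_le (hp0 : 0 ≤ p) (hp1 : p ≤ 1) (hij : i ≠ j) :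
    ∑ b : OffDiag V, cubeExp p (potentialEdges V) (fun s =>
        cubeDiff b.edge (fun s => triangleWeight p i j s * codegree i j s) s ^ 2)
      ≤ 5685568 * Fintype.card V * p * (1 + ((Fintype.card V : ℝ) - 2) * p ^ 2) ^ 2 := by
  have hpt : ∀ s, ∑ b : OffDiag V,
        cubeDiff b.edge (fun s => triangleWeight p i j s * codegree i j s) s ^ 2
      ≤ 392 * ∑ k ∈ otherVertices i j, ((coordInd s(i, k) s + p) * pathCount p i j s ^ 2
        + (coordInd s(j, k) s + p) * pathCount p i j s ^ 2) := by
    intro s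
    have h1 : ∑ b : OffDiag V, edgeInfluence p i j b.edge s
        ≤ 2 * ∑ k ∈ otherVertices i j, ((coordInd s(i, k) s + p) + (coordInd s(j, k) s + p)) := by
      simp only [edgeInfluence]
      rw [Finset.sum_comm, Finset.mul_sum]
      refine Finset.sum_le_sum fun k _ => ?_
      rw [Finset.sum_add_distrib, ← Finset.sum_mul, ← Finset.sum_mul]
      have h3 := add_nonneg (coordInd_nonneg (e := s(i, k)) s) hp0
      have h4 := add_nonneg (coordInd_nonneg (e := s(j, k)) s) hp0
      have h5 := mul_le_mul_of_nonneg_right (sum_ite_eq_edge_le_two (e := s(i, k))) h4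
      have h6 := mul_le_mul_of_nonneg_right (sum_ite_eq_edge_le_two (e := s(j, k))) h3
      linarith
    have h2 : ∀ b : OffDiag V,
        cubeDiff b.edge (fun s => triangleWeight p i j s * codegree i j s) s ^ 2
        ≤ 196 * pathCount p i j s ^ 2 * edgeInfluence p i j b.edge s := by
      intro b
      obtain ⟨h3, h4⟩ := cubeDiff_triangleWeight_mul_codegree_bounds hp0 hp1 hij b.edge s
      have h5 := edgeInfluence_le_four (i := i) (j := j) hp1 b.edge s
      have h6 := edgeInfluence_nonneg (i := i) (j := j) hp0 b.edge s
      have h7 := pow_le_pow_left₀ h3 h4 2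
      have h8 : 0 ≤ pathCount p i j s ^ 2 * edgeInfluence p i j b.edge s := by positivity
      nlinarith [mul_le_mul_of_nonneg_left h5 h8]
    refine (Finset.sum_le_sum fun b _ => h2 b).trans ?_
    rw [← Finset.mul_sum]
    refine (mul_le_mul_of_nonneg_left h1 (by positivity)).trans_eq ?_
    rw [Finset.mul_sum, Finset.mul_sum, Finset.mul_sum]
    exact Finset.sum_congr rfl fun k _ => by ring
  have hE := cubeExp_pathCount_sq_le hp0 hp1 hij
  rw [← cubeExp_sum]
  refine (cubeExp_mono hp0 hp1 fun s _ => hpt s).trans ?_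
  rw [cubeExp_const_mul, cubeExp_sum]
  have hk : ∀ k ∈ otherVertices i j, cubeExp p (potentialEdges V)
        (fun s => (coordInd s(i, k) s + p) * pathCount p i j s ^ 2
          + (coordInd s(j, k) s + p) * pathCount p i j s ^ 2)
      ≤ 74 * p * (196 * (1 + ((Fintype.card V : ℝ) - 2) * p ^ 2) ^ 2) := by
    intro k hk
    rw [cubeExp_add]
    have h1 := cubeExp_coordInd_add_mul_le hp0 hp1 (edge_mem_left hk)
      (F := fun s => pathCount p i j s ^ 2)
      (pathCount_pow_insert_le (i := i) (j := j) hp0 hp1 2 s(i, k))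
    have h2 := cubeExp_coordInd_add_mul_le hp0 hp1 (edge_mem_right hk)
      (F := fun s => pathCount p i j s ^ 2)
      (pathCount_pow_insert_le (i := i) (j := j) hp0 hp1 2 s(j, k))
    have h3 := mul_le_mul_of_nonneg_left hE hp0
    norm_num at h1 h2
    linarith
  have h1 := Finset.sum_le_sum hk
  rw [Finset.sum_const, nsmul_eq_mul] at h1
  have h2 := mul_le_mul_of_nonneg_right (card_otherVertices_le hij)
    (by positivity : 0 ≤ 74 * p * (196 * (1 + ((Fintype.card V : ℝ) - 2) * p ^ 2) ^ 2))
  linarith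

/-- The total influence of the edge `uv` through pairs `uk`. -/
lemma cubeExp_sq_sum_pathCount_le (hp0 : 0 ≤ p) (hp1 : p ≤ 1) {u v : V} (huv : u ≠ v) :
    cubeExp p (potentialEdges V) (fun s => (∑ k ∈ otherVertices u v,
        pathCount p u k s * (coordInd s(k, v) s + p)) ^ 2)
      ≤ 529396 * (Fintype.card V * p) * (1 + Fintype.card V * p)
        * (1 + ((Fintype.card V : ℝ) - 2) * p ^ 2) ^ 2 := by
  set Q : Finset (Sym2 V) → ℝ :=
    fun s => 1 + ∑ k ∈ otherVertices u v, (coordInd s(v, k) s + p) with hQ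
  have hQ1 : ∀ s, 1 ≤ Q s := fun s => le_add_of_nonneg_right
    (Finset.sum_nonneg fun k _ => add_nonneg (coordInd_nonneg s) hp0)
  have hQins : ∀ a s, Q (insert a s) ≤ 2 * Q s := by
    intro a s
    have h1 : Q (insert a s) ≤ Q s
        + ∑ k ∈ otherVertices u v, (if s(v, k) = a then (1 : ℝ) else 0) := by
      simp only [hQ]
      rw [add_assoc, ← Finset.sum_add_distrib]
      refine add_le_add le_rfl (Finset.sum_le_sum fun k _ => ?_)
      linarith [coordInd_insert_le (e := s(v, k)) a s]
    have h2 := sum_ite_edge_le_one (otherVertices u v) v a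
    linarith [hQ1 s]
  -- Cauchy-Schwarz, with the vertex sum of the weights `x_{vk} + p` bounded by `Q`.
  have hpt : ∀ s, (∑ k ∈ otherVertices u v, pathCount p u k s * (coordInd s(k, v) s + p)) ^ 2
      ≤ ∑ k ∈ otherVertices u v,
        (coordInd s(v, k) s + p) * (pathCount p u k s ^ 2 * Q s) := by
    intro s
    have h := Finset.sum_sq_le_sum_mul_sum_of_sq_le_mul (otherVertices u v)
      (r := fun k => pathCount p u k s * (coordInd s(v, k) s + p))
      (f := fun k => (coordInd s(v, k) s + p) * pathCount p u k s ^ 2)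
      (g := fun k => coordInd s(v, k) s + p)
      (fun k _ => mul_nonneg (add_nonneg (coordInd_nonneg s) hp0) (sq_nonneg _))
      (fun k _ => add_nonneg (coordInd_nonneg s) hp0) (fun k _ => by apply le_of_eq; ring)
    simp only [Sym2.eq_swap (b := v)]
    refine h.trans ?_
    simp only [← mul_assoc]
    rw [← Finset.sum_mul]
    refine mul_le_mul_of_nonneg_left (by simp only [hQ]; linarith)
      (Finset.sum_nonneg fun k _ =>
        mul_nonneg (add_nonneg (coordInd_nonneg s) hp0) (sq_nonneg _))
  refine (cubeExp_mono hp0 hp1 fun s _ => hpt s).trans ?_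
  rw [cubeExp_sum]
  have hμ := card_sub_two_nonneg huv
  have hk : ∀ k ∈ otherVertices u v, cubeExp p (potentialEdges V)
        (fun s => (coordInd s(v, k) s + p) * (pathCount p u k s ^ 2 * Q s))
      ≤ 73 * p * ((1 + 37 * (Fintype.card V * p))
        * (196 * (1 + ((Fintype.card V : ℝ) - 2) * p ^ 2) ^ 2)) := by
    intro k hk
    have huk : u ≠ k := (Finset.mem_filter.1 hk).2.1.symm
    have hE := cubeExp_pathCount_sq_le hp0 hp1 huk
    have hE0 : 0 ≤ cubeExp p (potentialEdges V) (fun s => pathCount p u k s ^ 2) :=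
      cubeExp_nonneg hp0 hp1 fun s _ => sq_nonneg _
    have h1 := cubeExp_coordInd_add_mul_le hp0 hp1 (edge_mem_right hk) (c := 72)
      (F := fun s => pathCount p u k s ^ 2 * Q s) fun s => by
        have h2 := mul_le_mul (pathCount_pow_insert_le (i := u) (j := k) hp0 hp1 2 s(v, k) s)
          (hQins s(v, k) s) (zero_le_one.trans (hQ1 _)) (by positivity)
        linarith
    have h3 : cubeExp p (potentialEdges V) (fun s => pathCount p u k s ^ 2 * Q s)
        ≤ (1 + 37 * (Fintype.card V * p))
          * cubeExp p (potentialEdges V) (fun s => pathCount p u k s ^ 2) := by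
      have h4 : cubeExp p (potentialEdges V) (fun s => pathCount p u k s ^ 2 * Q s)
          = cubeExp p (potentialEdges V) (fun s => pathCount p u k s ^ 2)
            + ∑ l ∈ otherVertices u v, cubeExp p (potentialEdges V)
              (fun s => (coordInd s(v, l) s + p) * pathCount p u k s ^ 2) := by
        rw [← cubeExp_sum, ← cubeExp_add]
        refine cubeExp_congr fun s _ => ?_
        rw [← Finset.sum_mul]
        simp only [hQ]
        ring
      have h5 : ∀ l ∈ otherVertices u v, cubeExp p (potentialEdges V)
              (fun s => (coordInd s(v, l) s + p) * pathCount p u k s ^ 2)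
          ≤ 37 * p * cubeExp p (potentialEdges V) (fun s => pathCount p u k s ^ 2) := by
        intro l hl
        have := cubeExp_coordInd_add_mul_le hp0 hp1 (edge_mem_right hl)
          (F := fun s => pathCount p u k s ^ 2)
          (pathCount_pow_insert_le (i := u) (j := k) hp0 hp1 2 s(v, l))
        norm_num at this
        exact this
      have h6 := Finset.sum_le_sum h5
      rw [Finset.sum_const, nsmul_eq_mul] at h6
      have h7 := mul_le_mul_of_nonneg_right (card_otherVertices_le huv)
        (by positivity : 0 ≤ 37 * p
          * cubeExp p (potentialEdges V) (fun s => pathCount p u k s ^ 2))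
      rw [h4]
      linarith
    have h8 : (72 + 1) * p * cubeExp p (potentialEdges V) (fun s => pathCount p u k s ^ 2 * Q s)
        ≤ 73 * p * ((1 + 37 * (Fintype.card V * p))
          * (196 * (1 + ((Fintype.card V : ℝ) - 2) * p ^ 2) ^ 2)) := by
      norm_num
      refine mul_le_mul_of_nonneg_left (h3.trans ?_) (by positivity)
      exact mul_le_mul_of_nonneg_left hE (by positivity)
    exact h1.trans h8
  have h1 := Finset.sum_le_sum hk
  rw [Finset.sum_const, nsmul_eq_mul] at h1
  have h2 := mul_le_mul_of_nonneg_right (card_otherVertices_le huv)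
    (by positivity : 0 ≤ 73 * p * ((1 + 37 * (Fintype.card V * p))
        * (196 * (1 + ((Fintype.card V : ℝ) - 2) * p ^ 2) ^ 2)))
  refine (h1.trans h2).trans ?_
  have h3 : 0 ≤ (Fintype.card V * p) * (1 + ((Fintype.card V : ℝ) - 2) * p ^ 2) ^ 2 := by
    positivity
  nlinarith

/-- The mean square of the effect of one edge on the sum over all pairs. -/
lemma cubeExp_sq_sum_cubeDiff_le (hp0 : 0 ≤ p) (hp1 : p ≤ 1) {a : Sym2 V}
    (ha : a ∈ potentialEdges V) :
    cubeExp p (potentialEdges V) (fun s => (∑ b : OffDiag V, cubeDiff a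
        (fun s => triangleWeight p b.1.1 b.1.2 s * codegree b.1.1 b.1.2 s) s) ^ 2)
      ≤ 415046464 * (Fintype.card V * p) * (1 + Fintype.card V * p)
        * (1 + ((Fintype.card V : ℝ) - 2) * p ^ 2) ^ 2 := by
  induction a using Sym2.ind with
  | _ u v =>
  have huv : u ≠ v := mem_potentialEdges.1 ha
  have hsum : ∀ s, ∑ b : OffDiag V, pathCount p b.1.1 b.1.2 s
        * edgeInfluence p b.1.1 b.1.2 s(u, v) s
      = 2 * (∑ k ∈ otherVertices u v, pathCount p u k s * (coordInd s(k, v) s + p)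
        + ∑ k ∈ otherVertices u v, pathCount p v k s * (coordInd s(k, u) s + p)) := by
    intro s
    set g : V → V → V → ℝ := fun i j k =>
      if s(i, j) = s(u, v) then pathCount p i k s * (coordInd s(k, j) s + p) else 0 with hg
    have h1 : ∑ b : OffDiag V, pathCount p b.1.1 b.1.2 s
        * edgeInfluence p b.1.1 b.1.2 s(u, v) s
        = tripleSum (fun i j k => g i k j) + tripleSum (fun i j k => g j k i) := by
      rw [← tripleSum_add, ← sum_offDiag_sum_otherVertices]
      refine Finset.sum_congr rfl fun b _ => ?_
      rw [edgeInfluence, Finset.mul_sum]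
      refine Finset.sum_congr rfl fun k _ => ?_
      simp only [hg, pathCount_comm (i := b.1.2) (j := b.1.1)]
      split_ifs <;> ring
    have h2 : tripleSum (fun i j k => g i k j) = tripleSum g :=
      (tripleSum_swap_right g).symm
    have h3 : tripleSum (fun i j k => g j k i) = tripleSum g := by
      rw [tripleSum_swap_left, h2]
    rw [h1, h2, h3, hg, tripleSum_ite_edge huv
      fun i j k => pathCount p i k s * (coordInd s(k, j) s + p)]
    ring
  have hpt : ∀ s, (∑ b : OffDiag V, cubeDiff s(u, v)
        (fun s => triangleWeight p b.1.1 b.1.2 s * codegree b.1.1 b.1.2 s) s) ^ 2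
      ≤ 392 * ((∑ k ∈ otherVertices u v, pathCount p u k s * (coordInd s(k, v) s + p)) ^ 2
        + (∑ k ∈ otherVertices v u, pathCount p v k s * (coordInd s(k, u) s + p)) ^ 2) := by
    intro s
    have h1 : ∑ b : OffDiag V, cubeDiff s(u, v)
        (fun s => triangleWeight p b.1.1 b.1.2 s * codegree b.1.1 b.1.2 s) s
        ≤ 7 * ∑ b : OffDiag V, pathCount p b.1.1 b.1.2 s
        * edgeInfluence p b.1.1 b.1.2 s(u, v) s := by
      rw [Finset.mul_sum]
      exact Finset.sum_le_sum fun b _ =>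
        (cubeDiff_triangleWeight_mul_codegree_bounds hp0 hp1 b.2 _ s).2
    have h0 : 0 ≤ ∑ b : OffDiag V, cubeDiff s(u, v)
        (fun s => triangleWeight p b.1.1 b.1.2 s * codegree b.1.1 b.1.2 s) s :=
      Finset.sum_nonneg fun b _ =>
        (cubeDiff_triangleWeight_mul_codegree_bounds hp0 hp1 b.2 _ s).1
    rw [hsum s, ← otherVertices_comm u v] at *
    refine (pow_le_pow_left₀ h0 h1 2).trans ?_
    nlinarith [sq_nonneg (∑ k ∈ otherVertices u v, pathCount p u k s * (coordInd s(k, v) s + p)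
      - ∑ k ∈ otherVertices u v, pathCount p v k s * (coordInd s(k, u) s + p))]
  refine (cubeExp_mono hp0 hp1 fun s _ => hpt s).trans ?_
  rw [cubeExp_const_mul, cubeExp_add]
  have h1 := cubeExp_sq_sum_pathCount_le hp0 hp1 huv
  have h2 := cubeExp_sq_sum_pathCount_le hp0 hp1 huv.symm
  linarith

/-! ### The variance of the triangle count -/

lemma cubeExp_coordInd_mul_coordInd {e e' : Sym2 V} (he : e ∈ potentialEdges V)
    (he' : e' ∈ potentialEdges V) (hee' : e ≠ e') :
    cubeExp p (potentialEdges V) (fun s => coordInd e s * coordInd e' s) = p ^ 2 := by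
  have h : cubeExp p (potentialEdges V) (coordInd e') = p := by
    have := cubeExp_coordInd_mul (p := p) (F := fun _ => 1) he'
    simpa [cubeExp_const] using this
  rw [cubeExp_coordInd_mul he]
  simp only [ignoresCoord_coordInd hee' _]
  rw [sq]
  exact congrArg _ h

lemma cubeExp_codegree (hij : i ≠ j) :
    cubeExp p (potentialEdges V) (codegree i j) = ((Fintype.card V : ℝ) - 2) * p ^ 2 := by
  unfold codegree
  rw [cubeExp_sum, Finset.sum_congr rfl fun k hk => cubeExp_coordInd_mul_coordInd
    (edge_mem_left hk) (edge_mem_right hk) (edge_ne hij hk), Finset.sum_const, nsmul_eq_mul,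
    card_otherVertices hij]

lemma le_cubeExp_triangleWeight_mul_codegree (hp0 : 0 ≤ p) (hp1 : p ≤ 1) (hij : i ≠ j) :
    6⁻¹ * ((((Fintype.card V : ℝ) - 2) * p ^ 2) * (1 + ((Fintype.card V : ℝ) - 2) * p ^ 2))
      ≤ cubeExp p (potentialEdges V) (fun s => triangleWeight p i j s * codegree i j s) := by
  have h : ∀ s, 6⁻¹ * (1 + ((Fintype.card V : ℝ) - 2) * p ^ 2) * codegree i j s
      ≤ triangleWeight p i j s * codegree i j s := by
    intro s
    have h0 := codegree_nonneg (i := i) (j := j) s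
    have h1 : 6⁻¹ * (codegree i j s + ((Fintype.card V : ℝ) - 2) * p ^ 2)
        ≤ triangleWeight p i j s := by
      rw [triangleWeight, codegree, ← card_otherVertices hij, ← nsmul_eq_mul,
        ← Finset.sum_const, ← Finset.sum_add_distrib]
      refine mul_le_mul_of_nonneg_left (Finset.sum_le_sum fun k _ => ?_) (by norm_num)
      linarith [mul_nonneg hp0 (coordInd_nonneg (e := s(j, k)) s)]
    -- The codegree is a sum of indicators, so it is at most its own square.
    have h2 : codegree i j s ≤ codegree i j s ^ 2 := by
      have h3 := Finset.sum_sq_le_sq_sum_of_nonneg (s := otherVertices i j)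
        (f := fun k => coordInd s(i, k) s * coordInd s(j, k) s)
        (fun k _ => mul_nonneg (coordInd_nonneg s) (coordInd_nonneg s))
      refine le_trans (Finset.sum_le_sum fun k _ => ?_) h3
      simp only [coordInd]
      split_ifs <;> norm_num
    nlinarith [mul_le_mul_of_nonneg_right h1 h0]
  have h1 := cubeExp_mono (S := potentialEdges V) hp0 hp1 fun s _ => h s
  rw [cubeExp_const_mul, cubeExp_codegree hij] at h1
  linarith

end Moments

section Variance

variable {V : Type*} [Fintype V] [DecidableEq V] {p : ℝ}

/-- The number of triangles of the graph with edge set `s`. -/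
noncomputable def triangleNumber (s : Finset (Sym2 V)) : ℝ :=
  (((SimpleGraph.fromEdgeSet (s : Set (Sym2 V))).cliqueSet 3).ncard : ℝ)

lemma card_offDiag : (Fintype.card (OffDiag V) : ℝ)
    = (Fintype.card V : ℝ) * ((Fintype.card V : ℝ) - 1) := by
  have h : Fintype.card (OffDiag V) = (Finset.univ : Finset V).offDiag.card := by
    rw [Fintype.card_subtype]
    congr 1
    ext t
    simp
  rw [h, Finset.offDiag_card, Nat.cast_sub (Nat.le_mul_self _), Finset.card_univ]
  push_cast
  ring

lemma card_potentialEdges_le :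
    ((potentialEdges V).card : ℝ) ≤ (Fintype.card V : ℝ) ^ 2 := by
  have h : (potentialEdges V).card ≤ Fintype.card (V × V) := by
    rw [← Finset.card_univ]
    refine Finset.card_le_card_of_surjOn (fun t : V × V => s(t.1, t.2)) fun e _ => ?_
    induction e using Sym2.ind with
    | _ u v => exact ⟨(u, v), by simp, rfl⟩
  rw [Fintype.card_prod, ← sq] at h
  exact_mod_cast h

lemma cubeExp_triangleNumber :
    cubeExp p (potentialEdges V) triangleNumber
      = 6⁻¹ * tripleSum (fun _ _ _ : V => p ^ 3) := by
  have h : cubeExp p (potentialEdges V)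
      (fun s => triangleNumber s - 6⁻¹ * tripleSum (fun _ _ _ : V => p ^ 3)) = 0 := by
    simp only [triangleNumber, ncard_cliqueSet_three_sub, cubeExp_sum]
    refine Finset.sum_eq_zero fun b _ => ?_
    have h1 := cubeExp_centred_mul (F := fun _ => 1) (p := p) b.edge_mem
      (ignoresCoord_triangleWeight (p := p) (i := b.1.1) (j := b.1.2))
    simp only [mul_one] at h1
    rw [h1]
    simp [cubeDiff, cubeExp_const]
  rw [cubeExp_sub, cubeExp_const] at h
  linarith

lemma triangleNumber_sub_cubeExp (s : Finset (Sym2 V)) :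
    triangleNumber s - cubeExp p (potentialEdges V) triangleNumber
      = ∑ b : OffDiag V, (coordInd b.edge s - p) * triangleWeight p b.1.1 b.1.2 s := by
  rw [cubeExp_triangleNumber]
  exact ncard_cliqueSet_three_sub p s

lemma cubeExp_sq_triangleNumber_sub :
    cubeExp p (potentialEdges V)
        (fun s => (triangleNumber s - cubeExp p (potentialEdges V) triangleNumber) ^ 2)
      = cubeExp p (potentialEdges V) (fun s => p * (1 - p) * ∑ b : OffDiag V,
        triangleWeight p b.1.1 b.1.2 s * codegree b.1.1 b.1.2 s) := by
  set m := cubeExp p (potentialEdges V) (triangleNumber (V := V)) with hm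
  have h1 : cubeExp p (potentialEdges V) (fun s => (triangleNumber s - m) ^ 2)
      = ∑ b : OffDiag V, cubeExp p (potentialEdges V) (fun s =>
        (coordInd b.edge s - p) * triangleWeight p b.1.1 b.1.2 s * (triangleNumber s - m)) := by
    rw [← cubeExp_sum]
    refine cubeExp_congr fun s _ => ?_
    rw [← Finset.sum_mul, ← triangleNumber_sub_cubeExp, ← hm, sq]
  rw [h1, cubeExp_const_mul, cubeExp_sum, Finset.mul_sum]
  refine Finset.sum_congr rfl fun b _ => ?_
  rw [cubeExp_centred_mul b.edge_mem ignoresCoord_triangleWeight]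
  congr 1
  refine cubeExp_congr fun s _ => ?_
  rw [← cubeDiff_ncard_cliqueSet_three b.2 s]
  simp only [cubeDiff, triangleNumber]
  ring

/-- The order of magnitude of the variance of the triangle count, from below. -/
lemma le_cubeExp_sum_triangleWeight_mul_codegree (hp0 : 0 ≤ p) (hp1 : p ≤ 1)
    (hn : 3 ≤ Fintype.card V) :
    9⁻¹ * (p * (1 - p) * (Fintype.card V : ℝ) ^ 2 * ((((Fintype.card V : ℝ) - 2) * p ^ 2)
        * (1 + ((Fintype.card V : ℝ) - 2) * p ^ 2)))
      ≤ cubeExp p (potentialEdges V) (fun s => p * (1 - p) * ∑ b : OffDiag V,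
        triangleWeight p b.1.1 b.1.2 s * codegree b.1.1 b.1.2 s) := by
  have hn' : (3 : ℝ) ≤ Fintype.card V := by exact_mod_cast hn
  have hq : 0 ≤ 1 - p := sub_nonneg.2 hp1
  have hn2 : 0 ≤ (Fintype.card V : ℝ) - 2 := by linarith
  rw [cubeExp_const_mul, cubeExp_sum]
  have h := Finset.sum_le_sum fun (b : OffDiag V) (_ : b ∈ Finset.univ) =>
    le_cubeExp_triangleWeight_mul_codegree hp0 hp1 b.2
  rw [Finset.sum_const, nsmul_eq_mul, Finset.card_univ, card_offDiag] at h
  have h1 := mul_le_mul_of_nonneg_left h (mul_nonneg hp0 hq)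
  refine le_trans ?_ h1
  set μ := ((Fintype.card V : ℝ) - 2) * p ^ 2
  have hμ : 0 ≤ μ := by positivity
  have h2 : 9⁻¹ * (Fintype.card V : ℝ) ^ 2
      ≤ (Fintype.card V : ℝ) * ((Fintype.card V : ℝ) - 1) * 6⁻¹ := by nlinarith
  have h3 := mul_le_mul_of_nonneg_right h2
    (by positivity : 0 ≤ p * (1 - p) * (μ * (1 + μ)))
  linarith

lemma cubeExp_sum_triangleWeight_mul_codegree_variance_le (hp0 : 0 ≤ p) (hp1 : p ≤ 1)
    (hn : 3 ≤ Fintype.card V) :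
    cubeExp p (potentialEdges V) (fun s => (p * (1 - p) * ∑ b : OffDiag V,
        triangleWeight p b.1.1 b.1.2 s * codegree b.1.1 b.1.2 s) ^ 2)
      - cubeExp p (potentialEdges V) (fun s => p * (1 - p) * ∑ b : OffDiag V,
        triangleWeight p b.1.1 b.1.2 s * codegree b.1.1 b.1.2 s) ^ 2
      ≤ 3 * 10 ^ 10 * (p * (1 - p) * (Fintype.card V : ℝ) ^ 2
        * ((((Fintype.card V : ℝ) - 2) * p ^ 2)
          * (1 + ((Fintype.card V : ℝ) - 2) * p ^ 2) ^ 3)) := by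
  have hn' : (3 : ℝ) ≤ Fintype.card V := by exact_mod_cast hn
  have hq : 0 ≤ 1 - p := sub_nonneg.2 hp1
  have hn2 : 0 ≤ (Fintype.card V : ℝ) - 2 := by linarith
  refine (cubeExp_poincare hp0 hp1 _ _).trans ?_
  have h1 : ∀ a ∈ potentialEdges V, cubeExp p (potentialEdges V)
      (fun s => cubeDiff a (fun s => p * (1 - p) * ∑ b : OffDiag V,
        triangleWeight p b.1.1 b.1.2 s * codegree b.1.1 b.1.2 s) s ^ 2)
      ≤ (p * (1 - p)) ^ 2 * (415046464 * (Fintype.card V * p) * (1 + Fintype.card V * p)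
        * (1 + ((Fintype.card V : ℝ) - 2) * p ^ 2) ^ 2) := by
    intro a ha
    refine le_trans (le_of_eq ?_) (mul_le_mul_of_nonneg_left
      (cubeExp_sq_sum_cubeDiff_le hp0 hp1 ha) (sq_nonneg _))
    rw [← cubeExp_const_mul]
    refine cubeExp_congr fun s _ => ?_
    simp only [cubeDiff, Finset.sum_sub_distrib]
    ring
  have h2 := Finset.sum_le_sum h1
  rw [Finset.sum_const, nsmul_eq_mul] at h2
  set N : ℝ := (Fintype.card V : ℝ) with hN
  set μ := (N - 2) * p ^ 2 with hμdef
  have hμ : 0 ≤ μ := by positivity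
  have h3 := mul_le_mul_of_nonneg_right (card_potentialEdges_le (V := V))
    (by positivity : 0 ≤ (p * (1 - p)) ^ 2 * (415046464 * (N * p) * (1 + N * p) * (1 + μ) ^ 2))
  -- `p² · np (1 + np) ≤ 9 μ (1 + μ)` because `n p² ≤ 3 μ`.
  have hNp : N * p ^ 2 ≤ 3 * μ := by
    rw [hμdef]
    nlinarith [sq_nonneg p]
  have h4 : (p * (1 - p)) ^ 2 * ((N * p) * (1 + N * p)) ≤ 9 * (μ * (1 + μ)) := by
    have h5 : (p * (1 - p)) ^ 2 ≤ p ^ 2 := by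
      refine pow_le_pow_left₀ (by positivity) ?_ 2
      nlinarith
    have h6 : N * p ^ 2 * p ≤ 3 * μ := by
      have : 0 ≤ N * p ^ 2 := by positivity
      nlinarith
    have h7 := pow_le_pow_left₀ (by positivity : 0 ≤ N * p ^ 2) hNp 2
    have h8 := mul_le_mul_of_nonneg_right h5 (by positivity : 0 ≤ (N * p) * (1 + N * p))
    nlinarith
  have h9 := mul_le_mul_of_nonneg_right h4
    (by positivity : 0 ≤ 415046464 * N ^ 2 * (1 + μ) ^ 2)
  have h10 := mul_le_mul_of_nonneg_left (h2.trans h3) (mul_nonneg hp0 hq)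
  refine h10.trans ?_
  have h11 := mul_le_mul_of_nonneg_left h9 (mul_nonneg hp0 hq)
  have h12 : 0 ≤ p * (1 - p) * N ^ 2 * (μ * (1 + μ) ^ 3) := by positivity
  linarith

lemma cubeExp_sq_sum_centred_triangleWeight_mul_codegree_le (hp0 : 0 ≤ p) (hp1 : p ≤ 1)
    (hn : 3 ≤ Fintype.card V) :
    cubeExp p (potentialEdges V) (fun s => (∑ b : OffDiag V, (coordInd b.edge s - p) *
        (triangleWeight p b.1.1 b.1.2 s * codegree b.1.1 b.1.2 s)) ^ 2)
      ≤ 3 * 10 ^ 10 * (p * (1 - p) * (Fintype.card V : ℝ) ^ 2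
        * ((((Fintype.card V : ℝ) - 2) * p ^ 2)
          * (1 + ((Fintype.card V : ℝ) - 2) * p ^ 2) ^ 3)) := by
  have hn' : (3 : ℝ) ≤ Fintype.card V := by exact_mod_cast hn
  have hq : 0 ≤ 1 - p := sub_nonneg.2 hp1
  have hn2 : 0 ≤ (Fintype.card V : ℝ) - 2 := by linarith
  refine (cubeExp_sq_sum_centred_le hp0 hp1 OffDiag.edge OffDiag.edge_mem ncard_edge_eq_le_two
    (fun b s => triangleWeight p b.1.1 b.1.2 s * codegree b.1.1 b.1.2 s)
    fun b => ignoresCoord_triangleWeight.mul ignoresCoord_codegree).trans ?_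
  have h1 := Finset.sum_le_sum fun (b : OffDiag V) (_ : b ∈ Finset.univ) =>
    cubeExp_sq_triangleWeight_mul_codegree_le hp0 hp1 b.2
  have h2 := Finset.sum_le_sum fun (b : OffDiag V) (_ : b ∈ Finset.univ) =>
    sum_cubeExp_sq_cubeDiff_le hp0 hp1 b.2
  rw [Finset.sum_const, nsmul_eq_mul, Finset.card_univ, card_offDiag] at h1 h2
  set N : ℝ := (Fintype.card V : ℝ) with hN
  set μ := (N - 2) * p ^ 2 with hμdef
  have hμ : 0 ≤ μ := by positivity
  have hcard : N * (N - 1) ≤ N ^ 2 := by nlinarith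
  have h3 := mul_le_mul_of_nonneg_right hcard
    (by positivity : 0 ≤ 217 ^ 2 * 268324 * μ * (1 + μ) ^ 3)
  have h4 := mul_le_mul_of_nonneg_right hcard
    (by positivity : 0 ≤ 5685568 * N * p * (1 + μ) ^ 2)
  have hpq := mul_nonneg hp0 hq
  have h5 := mul_le_mul_of_nonneg_left (h1.trans h3) (by positivity : 0 ≤ 2 * (p * (1 - p)))
  have h6 := mul_le_mul_of_nonneg_left (h2.trans h4) (sq_nonneg (p * (1 - p)))
  have hNp : N * p ^ 2 ≤ 3 * μ := by
    rw [hμdef]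
    nlinarith [sq_nonneg p]
  have h7 : N * p * (p * (1 - p)) ≤ 3 * μ := by
    have : 0 ≤ N * p ^ 2 * p := by positivity
    nlinarith
  have h8 := mul_le_mul_of_nonneg_right h7
    (by positivity : 0 ≤ p * (1 - p) * N ^ 2 * 5685568 * (1 + μ) ^ 2)
  have h9 : 0 ≤ p * (1 - p) * N ^ 2 * (μ * (1 + μ) ^ 3) := by positivity
  have h10 : 0 ≤ p * (1 - p) * N ^ 2 * (μ * (1 + μ) ^ 2 * μ) := by positivity
  linarith

/-! ### The Kolmogorov distance -/

/-- The normal approximation with a bound that is uniform over all densities: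
with `μ = (n - 2) p²`, the error is at most a constant times `((1 + μ) / (n² p (1 - p) μ))^{1/2}`. -/
theorem abs_cubeExp_triangleNumber_sub_cdf_le (hp0 : 0 < p) (hp1 : p < 1)
    (hn : 3 ≤ Fintype.card V) (x : ℝ) :
    |cubeExp p (potentialEdges V) (fun s =>
        if (triangleNumber s - cubeExp p (potentialEdges V) triangleNumber)
          / √(cubeExp p (potentialEdges V) (fun s =>
            (triangleNumber s - cubeExp p (potentialEdges V) triangleNumber) ^ 2)) ≤ x
        then 1 else 0) - cdf (gaussianReal 0 1) x|
      ≤ 4 * √(243 * 10 ^ 10 * ((1 + ((Fintype.card V : ℝ) - 2) * p ^ 2)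
        / (p * (1 - p) * (Fintype.card V : ℝ) ^ 2 * (((Fintype.card V : ℝ) - 2) * p ^ 2)))) := by
  have hn' : (3 : ℝ) ≤ Fintype.card V := by exact_mod_cast hn
  have hq : 0 < 1 - p := sub_pos.2 hp1
  have hn2 : 0 < (Fintype.card V : ℝ) - 2 := by linarith
  have hlow := le_cubeExp_sum_triangleWeight_mul_codegree hp0.le hp1.le hn
  have hA := cubeExp_sum_triangleWeight_mul_codegree_variance_le hp0.le hp1.le hn
  have hB := cubeExp_sq_sum_centred_triangleWeight_mul_codegree_le hp0.le hp1.le hn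
  rw [cubeExp_sq_triangleNumber_sub]
  set E := cubeExp p (potentialEdges V) with hE
  set m := E triangleNumber with hm
  set F : Finset (Sym2 V) → ℝ := fun s => p * (1 - p) * ∑ b : OffDiag V,
        triangleWeight p b.1.1 b.1.2 s * codegree b.1.1 b.1.2 s with hF
  set Z : Finset (Sym2 V) → ℝ := fun s => ∑ b : OffDiag V, (coordInd b.edge s - p) *
        (triangleWeight p b.1.1 b.1.2 s * codegree b.1.1 b.1.2 s) with hZ
  set N : ℝ := (Fintype.card V : ℝ) with hN
  set μ := (N - 2) * p ^ 2 with hμdef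
  have hμ : 0 < μ := by positivity
  have hN0 : 0 < N := by linarith
  set v := E F with hv
  change E (fun s => F s ^ 2) - v ^ 2 ≤ _ at hA
  change E (fun s => Z s ^ 2) ≤ _ at hB
  have hv0 : 0 < v := lt_of_lt_of_le (by positivity) hlow
  have hσ0 : 0 < √v := Real.sqrt_pos.2 hv0
  have hσ : √v * √v = v := Real.mul_self_sqrt hv0.le
  have hdiff : ∀ (b : OffDiag V) s,
      cubeDiff b.edge (fun s => (triangleNumber s - m) / √v) s
        = codegree b.1.1 b.1.2 s / √v := by
    intro b s
    rw [← cubeDiff_ncard_cliqueSet_three b.2 s]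
    simp only [cubeDiff, triangleNumber]
    ring
  have hignore : ∀ b : OffDiag V,
      IgnoresCoord b.edge (fun s => triangleWeight p b.1.1 b.1.2 s / √v) := fun b s =>
    congrArg (· / √v) (ignoresCoord_triangleWeight s)
  have hrepr : ∀ s ⊆ potentialEdges V, (triangleNumber s - m) / √v
      = ∑ b : OffDiag V, (coordInd b.edge s - p) * (triangleWeight p b.1.1 b.1.2 s / √v) := by
    intro s _
    rw [hm, hE, triangleNumber_sub_cubeExp, Finset.sum_div]
    exact Finset.sum_congr rfl fun b _ => by ring
  have hincr : ∀ (b : OffDiag V) s,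
      0 ≤ cubeDiff b.edge (fun s => (triangleNumber s - m) / √v) s := fun b s => by
    rw [hdiff]
    exact div_nonneg (codegree_nonneg s) hσ0.le
  have hstein := abs_cubeExp_sub_cdf_le (S := potentialEdges V) hp0.le hp1.le
    (fun s => (triangleNumber s - m) / √v) OffDiag.edge OffDiag.edge_mem
    (fun b s => triangleWeight p b.1.1 b.1.2 s / √v)
    (fun b s => div_nonneg (triangleWeight_nonneg hp0.le s) hσ0.le)
    hignore hrepr hincr x
  have hmul : ∀ (b : OffDiag V) s, triangleWeight p b.1.1 b.1.2 s / √v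
        * (codegree b.1.1 b.1.2 s / √v)
      = v⁻¹ * (triangleWeight p b.1.1 b.1.2 s * codegree b.1.1 b.1.2 s) := by
    intro b s
    rw [div_mul_div_comm, hσ]
    ring
  have hF' : ∀ s, p * (1 - p) * ∑ b : OffDiag V,
        v⁻¹ * (triangleWeight p b.1.1 b.1.2 s * codegree b.1.1 b.1.2 s) = v⁻¹ * F s := by
    intro s
    rw [← Finset.mul_sum, hF]
    ring
  have hZ' : ∀ s, ∑ b : OffDiag V, (coordInd b.edge s - p) *
        (v⁻¹ * (triangleWeight p b.1.1 b.1.2 s * codegree b.1.1 b.1.2 s)) = v⁻¹ * Z s := by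
    intro s
    rw [hZ, Finset.mul_sum]
    exact Finset.sum_congr rfl fun b _ => by ring
  simp only [hdiff, hmul, hF', hZ'] at hstein
  refine hstein.trans ?_
  -- Both error terms are at most the square root of `R`, since the lower bound for the variance
  -- is of order `n² p (1 - p) μ (1 + μ)`.
  set R := 243 * 10 ^ 10 * ((1 + μ) / (p * (1 - p) * N ^ 2 * μ)) with hR
  set G := p * (1 - p) * N ^ 2 with hG
  have hG0 : 0 < G := by positivity
  have hratio : ∀ y, y ≤ 3 * 10 ^ 10 * (G * (μ * (1 + μ) ^ 3)) → v⁻¹ ^ 2 * y ≤ R := by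
    intro y hy
    have h1 : v⁻¹ ≤ (9⁻¹ * (G * (μ * (1 + μ))))⁻¹ := inv_anti₀ (by positivity) hlow
    have h2 := pow_le_pow_left₀ (by positivity) h1 2
    calc v⁻¹ ^ 2 * y ≤ v⁻¹ ^ 2 * (3 * 10 ^ 10 * (G * (μ * (1 + μ) ^ 3))) := by gcongr
      _ ≤ (9⁻¹ * (G * (μ * (1 + μ))))⁻¹ ^ 2 * (3 * 10 ^ 10 * (G * (μ * (1 + μ) ^ 3))) := by
        gcongr
      _ = R := by
        rw [hR]
        field_simp
        ring
  have hfirst : cubeExp p (potentialEdges V) (fun s => |1 - v⁻¹ * F s|) ≤ √R := by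
    refine (cubeExp_abs_le_sqrt hp0.le hp1.le).trans (Real.sqrt_le_sqrt ?_)
    refine le_trans (le_of_eq ?_) (hratio _ hA)
    have h1 : cubeExp p (potentialEdges V) (fun s => (1 - v⁻¹ * F s) ^ 2)
        = 1 - 2 * v⁻¹ * E F + v⁻¹ ^ 2 * E (fun s => F s ^ 2) := by
      rw [hE, ← cubeExp_const_mul, ← cubeExp_const_mul,
        ← cubeExp_const (p := p) (S := potentialEdges V) 1, ← cubeExp_sub, ← cubeExp_add]
      refine cubeExp_congr fun s _ => ?_
      simp only [cubeExp_const]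
      ring
    rw [h1, ← hv]
    field_simp
    ring
  have hsecond : cubeExp p (potentialEdges V) (fun s => |v⁻¹ * Z s|) ≤ √R := by
    refine (cubeExp_abs_le_sqrt hp0.le hp1.le).trans (Real.sqrt_le_sqrt ?_)
    refine le_trans (le_of_eq ?_) (hratio _ hB)
    rw [hE, ← cubeExp_const_mul]
    exact cubeExp_congr fun s _ => by ring
  linarith

end Variance

/-- The law of `W` in terms of expectations over random edge sets. -/
lemma cdf_triangleLaw (n : ℕ) (p : unitInterval) (x : ℝ) :
    cdf (triangleLaw n p) x
      = cubeExp (p : ℝ) (potentialEdges (Fin n)) (fun s =>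
        if (triangleNumber s - cubeExp (p : ℝ) (potentialEdges (Fin n)) triangleNumber)
          / √(cubeExp (p : ℝ) (potentialEdges (Fin n)) (fun s =>
            (triangleNumber s - cubeExp (p : ℝ) (potentialEdges (Fin n)) triangleNumber) ^ 2)) ≤ x
        then 1 else 0) := by
  classical
  have := measurableSingletonClass_simpleGraph (Fin n)
  have hmeas : Measurable (normalizedTriangleCount n p) := Measurable.of_discrete
  have hT : Measurable (triangleCount (n := n)) := Measurable.of_discrete
  have : IsProbabilityMeasure (triangleLaw n p) :=
    Measure.isProbabilityMeasure_map hmeas.aemeasurable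
  have hmean : ∫ H, triangleCount H ∂(SimpleGraph.binomialRandom (Fin n) p)
      = cubeExp (p : ℝ) (potentialEdges (Fin n)) triangleNumber := integral_binomialRandom p _
  have hvar : variance triangleCount (SimpleGraph.binomialRandom (Fin n) p)
      = cubeExp (p : ℝ) (potentialEdges (Fin n)) (fun s =>
        (triangleNumber s - cubeExp (p : ℝ) (potentialEdges (Fin n)) triangleNumber) ^ 2) := by
    rw [variance_eq_integral hT.aemeasurable, integral_binomialRandom, hmean]
    rfl
  rw [cdf_eq_real, triangleLaw, map_measureReal_apply hmeas measurableSet_Iic,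
    ← integral_indicator_one (hmeas measurableSet_Iic), integral_binomialRandom]
  refine cubeExp_congr fun s _ => ?_
  rw [Set.indicator_apply]
  simp only [Set.mem_preimage, Set.mem_Iic, normalizedTriangleCount, hmean, hvar]
  rfl

lemma kolmogorovDist_triangleLaw_le {n : ℕ} (hn : 3 ≤ n) {p : unitInterval}
    (hp0 : 0 < (p : ℝ)) (hp1 : (p : ℝ) < 1) :
    kolmogorovDist (triangleLaw n p) (gaussianReal 0 1)
      ≤ 4 * √(243 * 10 ^ 10 * ((1 + ((n : ℝ) - 2) * (p : ℝ) ^ 2)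
        / ((p : ℝ) * (1 - (p : ℝ)) * (n : ℝ) ^ 2 * (((n : ℝ) - 2) * (p : ℝ) ^ 2)))) := by
  refine ciSup_le fun x => ?_
  have h := abs_cubeExp_triangleNumber_sub_cdf_le (V := Fin n) hp0 hp1 (by simpa using hn) x
  rw [← cdf_triangleLaw, Fintype.card_fin] at h
  exact h

/-- Each regime only requires comparing the uniform bound with its own denominator `z`; the factor
`15` is enough for all of them. -/
lemma kolmogorovDist_triangleLaw_le_div {n : ℕ} (hn : 3 ≤ n) {p : unitInterval}
    (hp0 : 0 < (p : ℝ)) (hp1 : (p : ℝ) < 1) {z : ℝ} (hz : 0 < z)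
    (h : (1 + ((n : ℝ) - 2) * (p : ℝ) ^ 2) * z ^ 2
      ≤ 15 * ((p : ℝ) * (1 - (p : ℝ)) * (n : ℝ) ^ 2 * (((n : ℝ) - 2) * (p : ℝ) ^ 2))) :
    kolmogorovDist (triangleLaw n p) (gaussianReal 0 1) ≤ 4 * √(243 * 10 ^ 10 * 15) / z := by
  have hn' : (3 : ℝ) ≤ n := by exact_mod_cast hn
  have hq : 0 < 1 - (p : ℝ) := sub_pos.2 hp1
  have hn2 : 0 < (n : ℝ) - 2 := by linarith
  refine (kolmogorovDist_triangleLaw_le hn hp0 hp1).trans ?_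
  rw [mul_div_assoc]
  refine mul_le_mul_of_nonneg_left ?_ (by norm_num)
  conv_rhs => rw [← Real.sqrt_sq hz.le, ← Real.sqrt_div' _ (sq_nonneg z)]
  refine Real.sqrt_le_sqrt ?_
  rw [mul_div_assoc]
  refine mul_le_mul_of_nonneg_left ?_ (by norm_num)
  rw [div_le_div_iff₀ (by positivity) (by positivity)]
  exact h

theorem theorem1 :
    ∃ C : ℝ, ∀ n : ℕ, 3 ≤ n → ∀ p : unitInterval, 0 < (p : ℝ) → (p : ℝ) < 1 →
      (1 / 2 < (p : ℝ) →
        kolmogorovDist (triangleLaw n p) (gaussianReal 0 1)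
          ≤ C / ((n : ℝ) * (1 - (p : ℝ)) ^ (1 / 2 : ℝ))) ∧
      ((n : ℝ) ^ (-(1 / 2) : ℝ) < (p : ℝ) → (p : ℝ) ≤ 1 / 2 →
        kolmogorovDist (triangleLaw n p) (gaussianReal 0 1)
          ≤ C / ((n : ℝ) * (p : ℝ) ^ (1 / 2 : ℝ))) ∧
      ((p : ℝ) ≤ (n : ℝ) ^ (-(1 / 2) : ℝ) →
        kolmogorovDist (triangleLaw n p) (gaussianReal 0 1)
          ≤ C / ((n : ℝ) ^ (3 / 2 : ℝ) * (p : ℝ) ^ (3 / 2 : ℝ))) := by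
  refine ⟨4 * √(243 * 10 ^ 10 * 15), fun n hn p hp0 hp1 => ?_⟩
  have hn' : (3 : ℝ) ≤ n := by exact_mod_cast hn
  have hn0 : (0 : ℝ) < n := by linarith
  have hq : 0 < 1 - (p : ℝ) := sub_pos.2 hp1
  have hn2 : 0 < (n : ℝ) - 2 := by linarith
  have hhalf : ∀ y : ℝ, 0 ≤ y → (y ^ (1 / 2 : ℝ)) ^ 2 = y := fun y hy => by
    rw [← Real.sqrt_eq_rpow, Real.sq_sqrt hy]
  have hcube : ∀ y : ℝ, 0 ≤ y → (y ^ (3 / 2 : ℝ)) ^ 2 = y ^ 3 := fun y hy => by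
    rw [← Real.rpow_natCast (y ^ (3 / 2 : ℝ)), ← Real.rpow_mul hy, ← Real.rpow_natCast y]
    norm_num
  have hthr : ((n : ℝ) ^ (-(1 / 2) : ℝ)) ^ 2 * n = 1 := by
    rw [Real.rpow_neg hn0.le, inv_pow, hhalf _ hn0.le, inv_mul_cancel₀ hn0.ne']
  have hthr0 : 0 < (n : ℝ) ^ (-(1 / 2) : ℝ) := Real.rpow_pos_of_pos hn0 _
  -- `μ = (n - 2) p²` is comparable to `n p²`.
  have hμ0 : 0 < ((n : ℝ) - 2) * (p : ℝ) ^ 2 := by positivity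
  have hμ : (n : ℝ) * (p : ℝ) ^ 2 ≤ 3 * (((n : ℝ) - 2) * (p : ℝ) ^ 2) := by
    nlinarith [sq_nonneg (p : ℝ)]
  refine ⟨fun h => ?_, fun h h' => ?_, fun h => ?_⟩
  · refine kolmogorovDist_triangleLaw_le_div hn hp0 hp1 (by positivity) ?_
    rw [mul_pow, hhalf _ hq.le]
    have h1 : 1 / 4 ≤ ((n : ℝ) - 2) * (p : ℝ) ^ 2 := by nlinarith
    have h2 : 1 + ((n : ℝ) - 2) * (p : ℝ) ^ 2
        ≤ 15 * ((p : ℝ) * (((n : ℝ) - 2) * (p : ℝ) ^ 2)) := by nlinarith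
    have h3 := mul_le_mul_of_nonneg_right h2
      (by positivity : 0 ≤ (n : ℝ) ^ 2 * (1 - (p : ℝ)))
    linarith
  · refine kolmogorovDist_triangleLaw_le_div hn hp0 hp1 (by positivity) ?_
    rw [mul_pow, hhalf _ hp0.le]
    have h1 : 1 ≤ (n : ℝ) * (p : ℝ) ^ 2 := by
      have := mul_le_mul_of_nonneg_right (pow_le_pow_left₀ hthr0.le h.le 2) hn0.le
      linarith
    have h2 : 1 + ((n : ℝ) - 2) * (p : ℝ) ^ 2
        ≤ 15 * ((1 - (p : ℝ)) * (((n : ℝ) - 2) * (p : ℝ) ^ 2)) := by nlinarith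
    have h3 := mul_le_mul_of_nonneg_right h2 (by positivity : 0 ≤ (n : ℝ) ^ 2 * (p : ℝ))
    linarith
  · refine kolmogorovDist_triangleLaw_le_div hn hp0 hp1 (by positivity) ?_
    rw [mul_pow, hcube _ hn0.le, hcube _ hp0.le]
    have h1 : (n : ℝ) * (p : ℝ) ^ 2 ≤ 1 := by
      have := mul_le_mul_of_nonneg_right (pow_le_pow_left₀ hp0.le h 2) hn0.le
      linarith
    have h2 : (p : ℝ) ≤ 3 / 5 := by nlinarith
    have h3 : ((n : ℝ) - 2) * (p : ℝ) ^ 2 ≤ 1 := by nlinarith [sq_nonneg (p : ℝ)]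
    have h4 : (1 + ((n : ℝ) - 2) * (p : ℝ) ^ 2) * ((n : ℝ) * (p : ℝ) ^ 2)
        ≤ 15 * ((1 - (p : ℝ)) * (((n : ℝ) - 2) * (p : ℝ) ^ 2)) := by
      refine (mul_le_mul_of_nonneg_left hμ (by positivity)).trans ?_
      nlinarith
    have h5 := mul_le_mul_of_nonneg_right h4 (by positivity : 0 ≤ (n : ℝ) ^ 2 * (p : ℝ))
    linarith
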